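/- Let $\mathcal{A}\subset\mathbb{R}$ be a finite set and let $\nu>0$. Then there exist positive constants $c_1,c_2,\theta_2$, depending only on $\mathcal{A}$ and $\nu$, such that the following holds for every integer $n\ge 1$, every choice of $\epsilon_1,\dots,\epsilon_n\in\mathcal{A}$ (not necessarily distinct), every integer $k$ with $|2k-n|\le 1$, and every $\eta\ge\nu$. Let $\pi$ be a uniform random permutation of $\{1,\dots,n\}$ and put $$\gamma^2=\frac1n\sum_{i=1}^n\epsilon_i^2,\qquad S_j=\sum_{i=1}^{j}\epsilon_{\pi(i)}\quad(0\le j\le n),\qquad W_k=S_k-\frac{k}{n}S_n,$$ where $S_n=\sum_{i=1}^n\epsilon_i$ is nonrandom. Then there exist, on a common probability space, a version of $W_k$ (a random variable with the same distribution as $W_k$) and a Gaussian random variable $Z_k$ with mean $0$ and variance $k(n-k)/n$ (equal to $0$ almost surely if this variance is zero) such that, for all real $\theta\le\theta_2$, $$\mathbb{E}\exp\bigl(\theta|W_k-\eta Z_k|\bigr)\le\exp\left(3+\frac{c_1\theta^2S_n^2}{n}+c_2\theta^2n(\gamma^2-\eta^2)^2\right).$$ -/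

import Mathlib

open MeasureTheory ProbabilityTheory

namespace PermWalk

/-- `S_k = ∑_{i=1}^k ε_{π(i)}`: the sum of the first `k` entries of `ε` listed in the order `π`
(the indices `1, …, n` are represented by `Fin n = {0, …, n - 1}`). -/
def partialSum {n : ℕ} (ε : Fin n → ℝ) (π : Equiv.Perm (Fin n)) (k : ℕ) : ℝ :=
  ∑ i : Fin n with i.val < k, ε (π i)

/-- The total `S_n`, which does not depend on the permutation (see `partialSum_self`). -/
def total {n : ℕ} (ε : Fin n → ℝ) : ℝ := ∑ i, ε i

theorem partialSum_self {n : ℕ} (ε : Fin n → ℝ) (π : Equiv.Perm (Fin n)) :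
    partialSum ε π n = total ε := by
  unfold partialSum total
  rw [Finset.filter_true_of_mem (fun i _ => i.isLt)]
  exact Equiv.sum_comp π ε

/-- `W_k = S_k - k S_n / n`. -/
noncomputable def bridge {n : ℕ} (ε : Fin n → ℝ) (k : ℕ) (π : Equiv.Perm (Fin n)) : ℝ :=
  partialSum ε π k - k * partialSum ε π n / n

/-- `γ² = n⁻¹ ∑ ε_i²`. -/
noncomputable def gammaSq {n : ℕ} (ε : Fin n → ℝ) : ℝ := (∑ i, ε i ^ 2) / n

/-- The distribution on `ℝ` of `W_k` when `π` is a uniform random permutation. -/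
noncomputable def bridgeLaw {n : ℕ} (ε : Fin n → ℝ) (k : ℕ) : Measure ℝ :=
  ((PMF.uniformOfFintype (Equiv.Perm (Fin n))).map (bridge ε k)).toMeasure

end PermWalk

/-!
The proof replaces the bridge by a sum of independent random signs and couples sign sums with
Gaussian variables one dimension at a time.

Pair the position `i` with its reflection `i.rev`. Exchanging the two entries of a pair preserves
the law of a uniform permutation, changes the sign of `halfDiff ε π i = (ε (π i) - ε (π i.rev)) / 2`
and fixes both the other half differences and `pairCenter ε k π`, which is the bridge minus the sum
of the half differences over the left half and is bounded because `|2k - n| ≤ 1`. Hence the bridge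
is distributed as `pairCenter` plus a sum of half differences with independent random signs
(`charFun_bridgeLaw`). As the entries lie in the finite set `A`, there are only `|A|²` kinds of
pairs, and the sum is a combination, with bounded coefficients, of boundedly many sign sums whose
lengths are the numbers of pairs of each kind.

A sum of `M` random signs can be realised as a function of Gaussian variables at distance
`O(1 + g²)` of `√M g`, uniformly in `M` (`exists_sign_sum_coupling`). This is the quantile coupling;
the required comparison of tails follows from termwise comparison of binomial probabilities with
the Gaussian density, using Wallis' product at the centre and the two-sided bounds on
`log ((1 + x) / (1 - x))` for the ratios (`centralTail_le_gaussianReal`,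
`gaussianReal_le_centralTail`).

Given the pairs, the Gaussian combination is `√V ζ` with `V = pairVariance ε k π` and `ζ` standard
Gaussian whatever the pairs are, so `ζ` is independent of `π` and the Gaussian variable of the
theorem can be taken to be `√(k (n - k) / n) ζ`. It remains to control
`(√V - η √(k (n - k) / n))²`, which is at most a constant times
`(V - η² k (n - k) / n)² / (ν² n)` (`exists_sq_sqrt_pairVariance_sub_le`). The mean of `V` is
`γ² k (n - k) / n` up to `O(1 + Sₙ² / n)`, and `V` is concentrated around its mean on the scale
`√n`, since a transposition moves it by a bounded amount (`sum_exp_perm_le`,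
`sum_exp_sq_pairVariance_le`). The errors are combined by `integral_exp_couplingSpace_le` and
`mul_sum_exp_le`.
-/

/-! ### Quantile couplings on the line -/

section Quantile

open Filter Topology Set

/-- The quantile coupling: if the distribution function of `ρ` is continuous and strictly
increasing, then `μ` is the law under `ρ` of a monotone function `q`, and `q` is characterised by
the Galois connection with the distribution functions, which turns comparisons of tails into
bounds on `q`. -/
theorem exists_quantile_map (μ ρ : Measure ℝ) [IsProbabilityMeasure μ] [IsProbabilityMeasure ρ]
    (hc : Continuous (cdf ρ)) (hs : StrictMono (cdf ρ)) :
    ∃ q : ℝ → ℝ, Monotone q ∧ ρ.map q = μ ∧ ∀ g x, q g ≤ x ↔ ρ.real (Iic g) ≤ μ.real (Iic x) := by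
  have hpos : ∀ g, 0 < cdf ρ g := fun g =>
    (cdf_nonneg ρ (g - 1)).trans_lt (hs (by linarith))
  have hlt : ∀ g, cdf ρ g < 1 := fun g =>
    (hs (show g < g + 1 by linarith)).trans_le (cdf_le_one ρ _)
  set q : ℝ → ℝ := fun g => sInf {x | cdf ρ g ≤ cdf μ x} with hq
  have hne : ∀ g, {x | cdf ρ g ≤ cdf μ x}.Nonempty := fun g =>
    (((tendsto_cdf_atTop μ).eventually (lt_mem_nhds (hlt g))).exists).imp fun x hx => le_of_lt hx
  have hbdd : ∀ g, BddBelow {x | cdf ρ g ≤ cdf μ x} := by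
    intro g
    obtain ⟨b, hb⟩ := ((tendsto_cdf_atBot μ).eventually (gt_mem_nhds (hpos g))).exists
    refine ⟨b, fun x hx => ?_⟩
    by_contra hlt'
    exact absurd (hx.trans (monotone_cdf μ (le_of_lt (not_le.1 hlt')))) (not_le.2 hb)
  have hmem : ∀ g, cdf ρ g ≤ cdf μ (q g) := by
    intro g
    have hr : Tendsto (cdf μ) (𝓝[>] (q g)) (𝓝 (cdf μ (q g))) :=
      ((cdf μ).right_continuous (q g)).mono Ioi_subset_Ici_self
    refine ge_of_tendsto hr ?_
    filter_upwards [self_mem_nhdsWithin] with x hx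
    obtain ⟨y, hy, hyx⟩ := exists_lt_of_csInf_lt (hne g) hx
    exact le_trans hy (monotone_cdf μ hyx.le)
  have hgal : ∀ g x, q g ≤ x ↔ cdf ρ g ≤ cdf μ x := fun g x =>
    ⟨fun h => (hmem g).trans (monotone_cdf μ h), fun h => csInf_le (hbdd g) h⟩
  have hmono : Monotone q := fun g g' h =>
    (hgal g _).2 ((monotone_cdf ρ h).trans (hmem g'))
  refine ⟨q, hmono, ?_, fun g x => by rw [hgal, cdf_eq_real, cdf_eq_real]⟩
  have : IsProbabilityMeasure (ρ.map q) := Measure.isProbabilityMeasure_map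
    hmono.measurable.aemeasurable
  refine Measure.eq_of_cdf _ _ (StieltjesFunction.ext fun x => ?_)
  rw [cdf_eq_real, map_measureReal_apply hmono.measurable measurableSet_Iic]
  have hset : q ⁻¹' Iic x = {g | cdf ρ g ≤ cdf μ x} := by
    ext g; simp [hgal]
  rw [hset]
  rcases (cdf_nonneg μ x).eq_or_lt with h0 | h0
  · have : {g | cdf ρ g ≤ cdf μ x} = ∅ := by
      ext g; simp [← h0, hpos g]
    rw [this, ← h0]; simp
  rcases (cdf_le_one μ x).eq_or_lt with h1 | h1
  · have : {g | cdf ρ g ≤ cdf μ x} = univ := by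
      ext g; simp [h1, (hlt g).le]
    rw [this, h1]; simp
  obtain ⟨a, ha⟩ := ((tendsto_cdf_atBot ρ).eventually (gt_mem_nhds h0)).exists
  obtain ⟨b, hb⟩ := ((tendsto_cdf_atTop ρ).eventually (lt_mem_nhds h1)).exists
  obtain ⟨y, hy⟩ := mem_range_of_exists_le_of_exists_ge hc ⟨a, ha.le⟩ ⟨b, hb.le⟩
  have : {g | cdf ρ g ≤ cdf μ x} = Iic y := by
    ext g; simp [← hy, hs.le_iff_le]
  rw [this, ← hy, cdf_eq_real]

theorem continuous_cdf_gaussianReal (m : ℝ) {v : NNReal} (hv : v ≠ 0) :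
    Continuous (cdf (gaussianReal m v)) := by
  rw [continuous_iff_continuousAt]
  intro a
  have := nullSingletonClass_gaussianReal (μ := m) hv
  have h := (cdf (gaussianReal m v)).measure_singleton a
  rw [measure_cdf, measure_singleton, eq_comm, ENNReal.ofReal_eq_zero] at h
  have hm := (cdf (gaussianReal m v)).mono
  rw [hm.continuousAt_iff_leftLim_eq_rightLim, StieltjesFunction.rightLim_eq]
  exact le_antisymm (hm.leftLim_le le_rfl) (by linarith)

theorem strictMono_cdf_gaussianReal (m : ℝ) {v : NNReal} (hv : v ≠ 0) :
    StrictMono (cdf (gaussianReal m v)) := by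
  intro a b hab
  have hpos : 0 < (gaussianReal m v) (Ioc a b) := by
    rw [pos_iff_ne_zero]
    intro h
    have h' := gaussianReal_absolutelyContinuous' m hv h
    rw [Real.volume_Ioc, ENNReal.ofReal_eq_zero] at h'
    linarith
  rw [← measure_cdf (gaussianReal m v), StieltjesFunction.measure_Ioc, ENNReal.ofReal_pos] at hpos
  linarith

end Quantile

/-! ### Estimates for centred Gaussian measures -/

section Gaussian

open Set

theorem gaussianReal_map_neg_zero (v : NNReal) :
    (gaussianReal 0 v).map (fun x => -x) = gaussianReal 0 v := by
  rw [gaussianReal_map_neg, neg_zero]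

theorem gaussianReal_real_Ici_le (v : NNReal) (hv : v ≠ 0) {y : ℝ} (hy : 0 ≤ y) :
    (gaussianReal 0 v).real (Ici y) ≤ Real.exp (-y ^ 2 / (2 * v)) := by
  have hv' : (0 : ℝ) < v := by positivity
  have h := measure_ge_le_exp_mul_mgf (μ := gaussianReal 0 v) (X := id) (t := y / v) y
    (by positivity) (integrable_exp_mul_gaussianReal _)
  rw [mgf_id_gaussianReal, ← Real.exp_add] at h
  refine (le_of_eq ?_).trans (h.trans (le_of_eq ?_))
  · rfl
  · congr 1
    field_simp
    ring

theorem gaussianPDFReal_antitoneOn (v : NNReal) : AntitoneOn (gaussianPDFReal 0 v) (Ici 0) := by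
  intro a ha b hb hab
  have ha' : (0 : ℝ) ≤ a := ha
  rw [gaussianPDFReal_def]
  simp only [sub_zero]
  gcongr

theorem gaussianReal_real_eq_integral (v : NNReal) (hv : v ≠ 0) {a b : ℝ} (hab : a ≤ b) :
    (gaussianReal 0 v).real (Ioc a b) = ∫ x in a..b, gaussianPDFReal 0 v x := by
  rw [measureReal_def, gaussianReal_apply_eq_integral 0 hv, ENNReal.toReal_ofReal,
    intervalIntegral.integral_of_le hab]
  exact setIntegral_nonneg measurableSet_Ioc fun x _ => gaussianPDFReal_nonneg _ _ _

theorem gaussianReal_real_Ioc_le (v : NNReal) (hv : v ≠ 0) {a b : ℝ} (ha : 0 ≤ a) (hab : a ≤ b) :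
    (gaussianReal 0 v).real (Ioc a b) ≤ (b - a) * gaussianPDFReal 0 v a := by
  rw [gaussianReal_real_eq_integral v hv hab]
  have h := intervalIntegral.integral_mono_on hab
    (integrable_gaussianPDFReal 0 v).intervalIntegrable
    (intervalIntegrable_const (μ := volume) (c := gaussianPDFReal 0 v a))
    (fun x hx => gaussianPDFReal_antitoneOn v ha (ha.trans hx.1) hx.1)
  simpa using h

theorem le_gaussianReal_real_Ioc (v : NNReal) (hv : v ≠ 0) {a b : ℝ} (ha : 0 ≤ a) (hab : a ≤ b) :
    (b - a) * gaussianPDFReal 0 v b ≤ (gaussianReal 0 v).real (Ioc a b) := by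
  rw [gaussianReal_real_eq_integral v hv hab]
  have h := intervalIntegral.integral_mono_on hab
    (intervalIntegrable_const (μ := volume) (c := gaussianPDFReal 0 v b))
    (integrable_gaussianPDFReal 0 v).intervalIntegrable
    (fun x hx => gaussianPDFReal_antitoneOn v (ha.trans hx.1) (ha.trans hab) hx.2)
  simpa using h

theorem exp_sq_div_four_gaussian (x : ℝ) :
    gaussianPDFReal 0 1 x • Real.exp (x ^ 2 / 4)
      = (Real.sqrt (2 * Real.pi))⁻¹ * Real.exp (-(1 / 4) * x ^ 2) := by
  rw [gaussianPDFReal_def, smul_eq_mul, mul_assoc, ← Real.exp_add]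
  simp only [NNReal.coe_one, mul_one, sub_zero]
  congr 2
  ring

theorem integrable_exp_sq_div_four :
    Integrable (fun x : ℝ => Real.exp (x ^ 2 / 4)) (gaussianReal 0 1) := by
  rw [gaussianReal_of_var_ne_zero _ one_ne_zero,
    integrable_withDensity_iff_integrable_smul' (measurable_gaussianPDF 0 1)
      (Filter.Eventually.of_forall fun _ => gaussianPDF_lt_top)]
  simp only [toReal_gaussianPDF, exp_sq_div_four_gaussian]
  exact (integrable_exp_neg_mul_sq (by norm_num)).const_mul _

theorem integral_exp_sq_div_four :
    ∫ x : ℝ, Real.exp (x ^ 2 / 4) ∂(gaussianReal 0 1) = Real.sqrt 2 := by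
  rw [integral_gaussianReal_eq_integral_smul one_ne_zero]
  simp only [exp_sq_div_four_gaussian]
  rw [integral_const_mul, integral_gaussian, ← Real.sqrt_inv, ← Real.sqrt_mul (by positivity)]
  congr 1
  field_simp
  norm_num

end Gaussian

/-! ### Local estimates for the symmetric binomial distribution -/

section Binomial

open Finset

/-- The probability `C(2n, n + j) / 4ⁿ` that a sum of `2n` independent random signs equals
`2j`. -/
noncomputable def centralProb (n j : ℕ) : ℝ := ((2 * n).choose (n + j) : ℝ) / 4 ^ n

/-- The probability that a sum of `2n` independent random signs is at least `2j`. -/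
noncomputable def centralTail (n j : ℕ) : ℝ := ∑ i ∈ Ico j (n + 1), centralProb n i

theorem centralProb_nonneg (n j : ℕ) : 0 ≤ centralProb n j := by
  unfold centralProb; positivity

theorem centralTail_eq_add {n j : ℕ} (h : j ≤ n) :
    centralTail n j = centralProb n j + centralTail n (j + 1) := by
  unfold centralTail
  rw [sum_eq_sum_Ico_succ_bot (by omega)]

theorem centralProb_self (n : ℕ) : centralProb n n = (4 ^ n)⁻¹ := by
  unfold centralProb
  rw [← two_mul, Nat.choose_self]
  simp

theorem inv_four_pow_le_centralTail {n j : ℕ} (h : j ≤ n) : ((4 : ℝ) ^ n)⁻¹ ≤ centralTail n j := by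
  rw [← centralProb_self]
  exact single_le_sum (f := centralProb n) (fun i _ => centralProb_nonneg n i)
    (by simp; omega)

theorem centralProb_succ (n j : ℕ) :
    centralProb n (j + 1) * (n + j + 1) = centralProb n j * (n - j) := by
  unfold centralProb
  have h := Nat.choose_succ_right_eq (2 * n) (n + j)
  rcases le_or_gt j n with hj | hj
  · have h2 : 2 * n - (n + j) = n - j := by omega
    rw [h2] at h
    have h3 : (((2 * n).choose (n + j + 1) : ℕ) : ℝ) * (n + j + 1)
        = ((2 * n).choose (n + j) : ℝ) * (n - j) := by
      have := congrArg (fun x : ℕ => (x : ℝ)) h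
      push_cast [hj] at this
      exact this
    rw [div_mul_eq_mul_div, div_mul_eq_mul_div, ← add_assoc, h3]
  · rw [Nat.choose_eq_zero_of_lt (by omega), Nat.choose_eq_zero_of_lt (by omega)]
    simp

/-- Wallis' product in terms of the central binomial probability. -/
theorem centralProb_zero_sq (n : ℕ) :
    centralProb n 0 ^ 2 = 1 / (Real.Wallis.W n * (2 * n + 1)) := by
  rw [Real.Wallis.W_eq_factorial_ratio]
  unfold centralProb
  have h : ((2 * n).choose n : ℝ) = (2 * n).factorial / (n.factorial * n.factorial) := by
    rw [Nat.cast_choose ℝ (by omega)]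
    congr 4
    omega
  rw [add_zero, h]
  have h4 : (2 : ℝ) ^ (4 * n) = (4 ^ n) ^ 2 := by
    rw [← pow_mul, show (4 : ℝ) = 2 ^ 2 by norm_num, ← pow_mul]
    congr 1
    ring
  rw [h4]
  have := n.factorial_ne_zero
  have := (2 * n).factorial_ne_zero
  field_simp

theorem centralProb_zero_le {n : ℕ} (hn : 1 ≤ n) :
    centralProb n 0 ≤ (Real.sqrt (Real.pi * n))⁻¹ := by
  have hn' : (1 : ℝ) ≤ n := by exact_mod_cast hn
  rw [← Real.sqrt_inv]
  apply Real.le_sqrt_of_sq_le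
  rw [centralProb_zero_sq, one_div]
  have hW := Real.Wallis.le_W n
  have hpi := Real.pi_pos
  apply inv_anti₀ (by positivity)
  calc Real.pi * n ≤ (2 * (n : ℝ) + 1) / (2 * n + 2) * (Real.pi / 2) * (2 * n + 1) := by
        rw [div_mul_eq_mul_div, div_mul_eq_mul_div, le_div_iff₀ (by positivity)]
        nlinarith
    _ ≤ _ := by gcongr

theorem le_centralProb_zero {n : ℕ} (hn : 1 ≤ n) :
    (Real.sqrt (Real.pi * n))⁻¹ * Real.exp (-(1 / (4 * n))) ≤ centralProb n 0 := by
  have hn' : (1 : ℝ) ≤ n := by exact_mod_cast hn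
  have hpi := Real.pi_pos
  apply le_of_sq_le_sq _ (centralProb_nonneg n 0)
  rw [centralProb_zero_sq, mul_pow, inv_pow, Real.sq_sqrt (by positivity), ← Real.exp_nat_mul]
  have hW := Real.Wallis.W_le n
  have hWp := Real.Wallis.W_pos n
  calc (Real.pi * n)⁻¹ * Real.exp ((2 : ℕ) * -(1 / (4 * n)))
      ≤ (Real.pi * n)⁻¹ * (1 + 1 / (2 * (n : ℝ)))⁻¹ := by
        gcongr
        rw [show ((2 : ℕ) : ℝ) * -(1 / (4 * (n : ℝ))) = -(1 / (2 * n)) by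
            push_cast; field_simp; norm_num,
          Real.exp_neg]
        apply inv_anti₀ (by positivity)
        have := Real.add_one_le_exp (1 / (2 * (n : ℝ)))
        linarith
    _ = 1 / (Real.pi / 2 * (2 * n + 1)) := by field_simp
    _ ≤ _ := by
        apply one_div_le_one_div_of_le (by positivity)
        gcongr

theorem one_sub_div_one_add_le {u : ℝ} (h0 : 0 ≤ u) (h1 : u < 1) :
    (1 - u) / (1 + u) ≤ Real.exp (-2 * u) := by
  have h := Real.sum_range_le_log_div h0 h1 1
  simp at h
  rw [← Real.log_le_iff_le_exp (by apply div_pos <;> linarith), ← inv_div, Real.log_inv]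
  linarith

theorem le_one_sub_div_one_add {u : ℝ} (h0 : 0 ≤ u) (h1 : u ≤ 1 / 2) :
    Real.exp (-2 * u - 3 * u ^ 3) ≤ (1 - u) / (1 + u) := by
  have h := Real.log_div_le_sum_range_add h0 (by linarith) 1
  simp at h
  have h3 : u ^ 3 / (1 - u ^ 2) ≤ 4 / 3 * u ^ 3 := by
    rw [div_le_iff₀ (by nlinarith)]
    have h3 : 0 ≤ u ^ 3 := by positivity
    have h2 : u ^ 2 ≤ 1 / 4 := by nlinarith
    nlinarith [mul_nonneg h3 (sub_nonneg.2 h2)]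
  rw [← Real.le_log_iff_exp_le (by apply div_pos <;> linarith), ← inv_div, Real.log_inv]
  have : 0 ≤ u ^ 3 := by positivity
  linarith

theorem centralProb_succ_ratio (n j : ℕ) :
    centralProb n (j + 1) = centralProb n j *
      ((1 - (2 * j + 1 : ℝ) / (2 * n + 1)) / (1 + (2 * j + 1 : ℝ) / (2 * n + 1))) := by
  have h := centralProb_succ n j
  have h1 : (0 : ℝ) < n + j + 1 := by positivity
  have h2 : (0 : ℝ) < 2 * n + 1 := by positivity
  have : (1 - (2 * j + 1 : ℝ) / (2 * n + 1)) / (1 + (2 * j + 1 : ℝ) / (2 * n + 1))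
      = (n - j) / (n + j + 1) := by
    rw [one_sub_div h2.ne', one_add_div h2.ne', div_div_div_cancel_right₀ h2.ne',
      div_eq_div_iff (by positivity) h1.ne']
    ring
  rw [this, ← mul_div_assoc, ← h, mul_div_cancel_right₀ _ h1.ne']

theorem centralProb_le {n : ℕ} (j : ℕ) (hj : j ≤ n) :
    centralProb n j ≤ centralProb n 0 * Real.exp (-(2 * j ^ 2 / (2 * n + 1))) := by
  induction j with
  | zero => simp
  | succ j ih =>
    have hj' : (j : ℝ) + 1 ≤ n := by exact_mod_cast hj
    rw [centralProb_succ_ratio]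
    have hu : (2 * j + 1 : ℝ) / (2 * n + 1) < 1 := by
      rw [div_lt_one (by positivity)]; linarith
    calc _ ≤ centralProb n 0 * Real.exp (-(2 * j ^ 2 / (2 * n + 1)))
          * Real.exp (-2 * ((2 * j + 1 : ℝ) / (2 * n + 1))) := by
          apply mul_le_mul (ih (by omega)) (one_sub_div_one_add_le (by positivity) hu)
          · apply div_nonneg
            · linarith
            · positivity
          · exact mul_nonneg (centralProb_nonneg _ _) (Real.exp_pos _).le
      _ = _ := by
          rw [mul_assoc, ← Real.exp_add]
          congr 2
          push_cast
          field_simp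
          ring

theorem le_centralProb {n : ℕ} (j : ℕ) (hj : 2 * j ≤ n + 1) :
    centralProb n 0 * Real.exp (-(2 * j ^ 2 / (2 * n + 1)) - 6 * j ^ 4 / (2 * n + 1) ^ 3)
      ≤ centralProb n j := by
  induction j with
  | zero => simp
  | succ j ih =>
    have hj' : 2 * (j : ℝ) + 1 ≤ n := by
      have : 2 * j + 1 ≤ n := by omega
      exact_mod_cast this
    rw [centralProb_succ_ratio]
    have hu : (2 * j + 1 : ℝ) / (2 * n + 1) ≤ 1 / 2 := by
      rw [div_le_iff₀ (by positivity)]; linarith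
    refine le_trans (le_of_eq_of_le rfl ?_) (mul_le_mul (ih (by omega))
      (le_one_sub_div_one_add (by positivity) hu) (Real.exp_pos _).le (centralProb_nonneg _ _))
    rw [mul_assoc, ← Real.exp_add]
    apply mul_le_mul_of_nonneg_left _ (centralProb_nonneg _ _)
    apply Real.exp_le_exp.2
    have key : 6 * (j : ℝ) ^ 4 / (2 * n + 1) ^ 3 + 3 * ((2 * j + 1 : ℝ) / (2 * n + 1)) ^ 3
        ≤ 6 * (j + 1 : ℝ) ^ 4 / (2 * n + 1) ^ 3 := by
      rw [div_pow, ← mul_div_assoc, ← add_div]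
      gcongr
      have : (0 : ℝ) ≤ j := by positivity
      nlinarith [pow_nonneg this 2]
    have e : 2 * ((j : ℝ) + 1) ^ 2 / (2 * n + 1)
        = 2 * (j : ℝ) ^ 2 / (2 * n + 1) + 2 * ((2 * j + 1 : ℝ) / (2 * n + 1)) := by
      field_simp
      ring
    push_cast
    rw [e]
    linarith

/-- The density at `y` of the centred Gaussian measure of variance `n / 2`. -/
theorem gaussianPDFReal_half (n : ℕ) (y : ℝ) :
    gaussianPDFReal 0 (n / 2 : NNReal) y
      = (Real.sqrt (Real.pi * n))⁻¹ * Real.exp (-(y ^ 2 / n)) := by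
  rw [gaussianPDFReal_def]
  push_cast
  rw [sub_zero]
  congr 3
  · ring
  · rcases eq_or_ne (n : ℝ) 0 with h | h
    · simp [h]
    · field_simp

theorem centralProb_le_gaussianPDFReal {n : ℕ} {j : ℕ} (hj1 : 1 ≤ j) (hj : j ≤ n) :
    centralProb n j ≤ gaussianPDFReal 0 (n / 2 : NNReal) (j - 1) := by
  have hn : 1 ≤ n := hj1.trans hj
  have h1 : (1 : ℝ) ≤ j := by exact_mod_cast hj1
  have h2 : (j : ℝ) ≤ n := by exact_mod_cast hj
  rw [gaussianPDFReal_half]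
  refine (centralProb_le j hj).trans ?_
  apply mul_le_mul (centralProb_zero_le hn) _ (Real.exp_pos _).le (by positivity)
  apply Real.exp_le_exp.2
  rw [neg_le_neg_iff, div_le_div_iff₀ (by linarith) (by positivity)]
  nlinarith

/-- The point whose Gaussian tail is dominated by the binomial tail at `x`. The quadratic
correction `4 x² / n` absorbs the quartic term of the rate function of the binomial
distribution. -/
noncomputable def shiftedPoint (n : ℕ) (x : ℝ) : ℝ := 4 + x + 4 * x ^ 2 / n

theorem le_shiftedPoint (n : ℕ) (x : ℝ) : 4 + x ≤ shiftedPoint n x := by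
  have : 0 ≤ 4 * x ^ 2 / n := by positivity
  unfold shiftedPoint
  linarith

theorem mul_gaussianPDFReal_le_centralProb {n : ℕ} (hn : 1 ≤ n) {j : ℕ} (hj : 2 * j ≤ n) :
    (shiftedPoint n (j + 1) - shiftedPoint n j) *
      gaussianPDFReal 0 (n / 2 : NNReal) (shiftedPoint n j) ≤ centralProb n j := by
  have h0 : (0 : ℝ) ≤ j := by positivity
  have h2 : 2 * (j : ℝ) ≤ n := by exact_mod_cast hj
  have hn' : (1 : ℝ) ≤ n := by exact_mod_cast hn
  have hn0 : (0 : ℝ) < n := by linarith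
  rw [gaussianPDFReal_half]
  refine le_trans ?_ (le_centralProb j (by omega))
  refine le_trans ?_ (mul_le_mul_of_nonneg_right (le_centralProb_zero hn) (Real.exp_pos _).le)
  rw [mul_left_comm, mul_assoc]
  apply mul_le_mul_of_nonneg_left _ (by positivity)
  have hd : shiftedPoint n (j + 1) - shiftedPoint n j ≤ Real.exp (4 * (2 * j + 1) / n) := by
    refine le_trans (le_of_eq ?_) (Real.add_one_le_exp _)
    unfold shiftedPoint
    field_simp
    ring
  refine (mul_le_mul_of_nonneg_right hd (Real.exp_pos _).le).trans ?_
  rw [← Real.exp_add, ← Real.exp_add]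
  apply Real.exp_le_exp.2
  have e1 : 2 * (j : ℝ) ^ 2 / (2 * n + 1) ≤ j ^ 2 / n := by
    rw [div_le_div_iff₀ (by positivity) hn0]
    nlinarith [sq_nonneg (j : ℝ)]
  have e2 : 6 * (j : ℝ) ^ 4 / (2 * n + 1) ^ 3 ≤ (j : ℝ) ^ 3 / (n : ℝ) ^ 2 := by
    calc 6 * (j : ℝ) ^ 4 / (2 * n + 1) ^ 3 ≤ 6 * (j : ℝ) ^ 4 / (2 * n) ^ 3 := by
          gcongr; linarith
      _ = (3 / 4 * ((j : ℝ) / n)) * ((j : ℝ) ^ 3 / (n : ℝ) ^ 2) := by field_simp; ring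
      _ ≤ 1 * ((j : ℝ) ^ 3 / (n : ℝ) ^ 2) := by
          gcongr
          have : (j : ℝ) / n ≤ 1 := by rw [div_le_one hn0]; linarith
          linarith
      _ = _ := one_mul _
  have e3 : (j : ℝ) ^ 2 / n + 4 * (2 * j + 1) / n + j ^ 3 / n ^ 2 + 1 / (4 * n)
      ≤ shiftedPoint n j ^ 2 / n := by
    have : (j : ℝ) ^ 2 / n + 4 * (2 * j + 1) / n + j ^ 3 / n ^ 2 + 1 / (4 * n)
      = (j ^ 2 + 4 * (2 * j + 1) + j ^ 3 / n + 1 / 4) / n := by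
      field_simp
    rw [this]
    gcongr
    have e : (4 + (j : ℝ)) ^ 2 + 8 * (j ^ 3 / n) ≤ shiftedPoint n j ^ 2 := by
      have : shiftedPoint n j ^ 2 = (4 + (j : ℝ)) ^ 2 + 8 * (j ^ 3 / n)
          + (32 * j ^ 2 / n + (4 * (j : ℝ) ^ 2 / n) ^ 2) := by
        unfold shiftedPoint; field_simp; ring
      rw [this]
      have : 0 ≤ 32 * (j : ℝ) ^ 2 / n + (4 * (j : ℝ) ^ 2 / n) ^ 2 := by positivity
      linarith
    have : 0 ≤ (j : ℝ) ^ 3 / n := by positivity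
    nlinarith
  linarith

theorem centralTail_le_gaussianReal {n : ℕ} {j : ℕ} (hj : 2 ≤ j) :
    centralTail n j ≤ (gaussianReal 0 (n / 2 : NNReal)).real (Set.Ioi ((j : ℝ) - 2)) := by
  rcases le_or_gt j n with hjn | hjn
  · have hv : (n / 2 : NNReal) ≠ 0 := by
      have : n ≠ 0 := by omega
      positivity
    refine Nat.decreasingInduction' (P := fun i => centralTail n i ≤
      (gaussianReal 0 (n / 2 : NNReal)).real (Set.Ioi ((i : ℝ) - 2))) (n := n + 1) (m := j)
      ?_ (by omega) ?_
    · intro i hi hji ih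
      have hi' : (2 : ℝ) ≤ i := by exact_mod_cast hj.trans hji
      rw [centralTail_eq_add (by omega)]
      have h1 : centralProb n i
          ≤ (gaussianReal 0 (n / 2 : NNReal)).real (Set.Ioc ((i : ℝ) - 2) (i - 1)) := by
        refine le_trans ?_ (le_gaussianReal_real_Ioc _ hv (by linarith) (by linarith))
        refine (centralProb_le_gaussianPDFReal (by omega) (by omega)).trans (le_of_eq ?_)
        ring
      rw [← Set.Ioc_union_Ioi_eq_Ioi (show (i : ℝ) - 2 ≤ i - 1 by linarith),
        measureReal_union (Set.Ioc_disjoint_Ioi le_rfl) measurableSet_Ioi]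
      push_cast at ih
      rw [show (i : ℝ) + 1 - 2 = i - 1 by ring] at ih
      linarith
    · unfold centralTail
      simp
  · unfold centralTail
    rw [Ico_eq_empty (by omega)]
    simp

theorem gaussianReal_le_centralTail {n : ℕ} (hn : 1 ≤ n) {j : ℕ} (hj : j ≤ n) :
    (gaussianReal 0 (n / 2 : NNReal)).real (Set.Ioi (shiftedPoint n j)) ≤ centralTail n j := by
  have hv : (n / 2 : NNReal) ≠ 0 := by
    have : n ≠ 0 := by omega
    positivity
  have hn' : (1 : ℝ) ≤ n := by exact_mod_cast hn
  -- Far in the tail the single atom `4⁻ⁿ` at the end point is enough.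
  have hfar : ∀ i : ℕ, n ≤ 2 * i → i ≤ n →
      (gaussianReal 0 (n / 2 : NNReal)).real (Set.Ioi (shiftedPoint n i)) ≤ centralTail n i := by
    intro i hi hin
    have hi' : (n : ℝ) ≤ 2 * i := by exact_mod_cast hi
    refine le_trans ?_ (inv_four_pow_le_centralTail hin)
    refine le_trans (measureReal_mono Set.Ioi_subset_Ici_self) ?_
    have hl : 3 / 2 * (n : ℝ) ≤ shiftedPoint n i := by
      have : (n : ℝ) ≤ 4 * i ^ 2 / n := by
        rw [le_div_iff₀ (by linarith)]
        nlinarith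
      unfold shiftedPoint
      linarith
    refine (gaussianReal_real_Ici_le _ hv (by linarith)).trans ?_
    rw [← inv_pow, ← Real.exp_log (show (0 : ℝ) < 4⁻¹ by norm_num), ← Real.exp_nat_mul]
    apply Real.exp_le_exp.2
    rw [Real.log_inv, show (4 : ℝ) = 2 ^ 2 by norm_num, Real.log_pow]
    have hl2 := Real.log_two_lt_d9
    have hp : (0 : ℝ) < Real.log 2 := Real.log_pos (by norm_num)
    push_cast
    rw [div_le_iff₀ (by positivity)]
    have : (3 / 2 * (n : ℝ)) ^ 2 ≤ shiftedPoint n i ^ 2 := by gcongr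
    nlinarith
  rcases le_or_gt n (2 * j) with h | h
  · exact hfar j h hj
  refine Nat.decreasingInduction' (P := fun i =>
      (gaussianReal 0 (n / 2 : NNReal)).real (Set.Ioi (shiftedPoint n i)) ≤ centralTail n i)
      (n := (n + 1) / 2) (m := j) ?_ (by omega) (hfar _ (by omega) (by omega))
  intro i hi hji ih
  rw [centralTail_eq_add (by omega)]
  have hle : shiftedPoint n i ≤ shiftedPoint n (i + 1) := by
    unfold shiftedPoint
    gcongr <;> linarith
  have h0 : 0 ≤ shiftedPoint n i := by
    have := le_shiftedPoint n i
    have : (0 : ℝ) ≤ i := by positivity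
    linarith
  have h1 := gaussianReal_real_Ioc_le _ hv h0 hle
  have h2 := mul_gaussianPDFReal_le_centralProb hn (j := i) (by omega)
  rw [← Set.Ioc_union_Ioi_eq_Ioi hle,
    measureReal_union (Set.Ioc_disjoint_Ioi le_rfl) measurableSet_Ioi]
  push_cast at ih
  linarith

end Binomial

/-! ### Coupling sums of random signs with Gaussian variables -/

section SignSums

open Finset

/-- The law of half the sum of `2n` independent random signs. -/
noncomputable def halfSignLaw (n : ℕ) : Measure ℝ :=
  ∑ m ∈ range (2 * n + 1),
    ENNReal.ofReal (((2 * n).choose m : ℝ) / 4 ^ n) • Measure.dirac ((m : ℝ) - n)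

theorem integral_halfSignLaw {E : Type*} [NormedAddCommGroup E] [NormedSpace ℝ E]
    [CompleteSpace E] (n : ℕ) (f : ℝ → E) :
    ∫ x, f x ∂(halfSignLaw n)
      = ∑ m ∈ range (2 * n + 1), (((2 * n).choose m : ℝ) / 4 ^ n) • f ((m : ℝ) - n) := by
  unfold halfSignLaw
  rw [integral_finsetSum_measure]
  · refine sum_congr rfl fun m _ => ?_
    rw [integral_smul_measure, integral_dirac, ENNReal.toReal_ofReal (by positivity)]
  · intro m _
    exact (integrable_dirac enorm_lt_top).smul_measure ENNReal.ofReal_ne_top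

instance isProbabilityMeasure_halfSignLaw (n : ℕ) : IsProbabilityMeasure (halfSignLaw n) := by
  constructor
  unfold halfSignLaw
  simp only [Measure.coe_finsetSum, Finset.sum_apply, Measure.smul_apply, measure_univ,
    smul_eq_mul, mul_one]
  rw [← ENNReal.ofReal_sum_of_nonneg (fun _ _ => by positivity), ← sum_div, ← Nat.cast_sum,
    Nat.sum_range_choose, pow_mul]
  norm_num

theorem halfSignLaw_real_Ioi (n j : ℕ) {x : ℝ} (h1 : (j : ℝ) ≤ x + 1) (h2 : x < j) :
    (halfSignLaw n).real (Set.Ioi x) = centralTail n j := by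
  rw [← integral_indicator_one measurableSet_Ioi, integral_halfSignLaw]
  have hiff : ∀ m : ℕ, (m : ℝ) - n ∈ Set.Ioi x ↔ n + j ≤ m := by
    intro m
    rw [Set.mem_Ioi]
    constructor
    · intro h
      have : ((n + j : ℕ) : ℝ) < (m + 1 : ℕ) := by push_cast; linarith
      have : n + j < m + 1 := by exact_mod_cast this
      omega
    · intro h
      have : ((n + j : ℕ) : ℝ) ≤ m := by exact_mod_cast h
      push_cast at this
      linarith
  simp only [Set.indicator_apply, hiff, Pi.one_apply, smul_eq_mul, mul_ite, mul_one, mul_zero]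
  rw [← sum_filter]
  have : (range (2 * n + 1)).filter (fun m => n + j ≤ m) = Ico (j + n) (n + 1 + n) := by
    ext m
    simp only [mem_filter, mem_range, mem_Ico]
    omega
  rw [this, ← sum_Ico_add']
  unfold centralTail centralProb
  simp only [add_comm]

theorem halfSignLaw_map_neg (n : ℕ) : (halfSignLaw n).map (fun x => -x) = halfSignLaw n := by
  have : IsProbabilityMeasure ((halfSignLaw n).map (fun x => -x)) :=
    Measure.isProbabilityMeasure_map measurable_neg.aemeasurable
  refine Measure.ext_of_charFun (funext fun t => ?_)
  rw [charFun_apply_real, charFun_apply_real, integral_map measurable_neg.aemeasurable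
    (by fun_prop), integral_halfSignLaw, integral_halfSignLaw, ← sum_range_reflect]
  refine sum_congr rfl fun m hm => ?_
  have hm' : m ≤ 2 * n := by simpa [Nat.lt_succ_iff] using hm
  rw [show 2 * n + 1 - 1 - m = 2 * n - m by omega, Nat.choose_symm hm']
  push_cast [hm']
  congr 4
  ring

theorem charFun_halfSignLaw (n : ℕ) (t : ℝ) :
    charFun (halfSignLaw n) (2 * t) = (Real.cos t : ℂ) ^ (2 * n) := by
  rw [charFun_apply_real, integral_halfSignLaw, Complex.ofReal_cos, Complex.cos, div_pow,
    add_pow, sum_div]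
  refine sum_congr rfl fun m hm => ?_
  have hm' : m ≤ 2 * n := by simpa [Nat.lt_succ_iff] using hm
  rw [← Complex.exp_nat_mul, ← Complex.exp_nat_mul, ← Complex.exp_add, pow_mul,
    Complex.real_smul]
  have : ((2 * t : ℝ) : ℂ) * (((m : ℝ) - n : ℝ) : ℂ) * Complex.I
      = (m : ℂ) * (t * Complex.I) + ((2 * n - m : ℕ) : ℂ) * (-t * Complex.I) := by
    push_cast [hm']
    ring
  rw [this]
  push_cast
  norm_num
  ring

theorem real_Iic_neg_of_map_neg {μ : Measure ℝ} (h : μ.map (fun x => -x) = μ) (x : ℝ) :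
    μ.real (Set.Iic (-x)) = μ.real (Set.Ici x) := by
  conv_rhs => rw [← h]
  rw [map_measureReal_apply measurable_neg measurableSet_Ici]
  congr 1
  ext y
  simp

theorem halfSignLaw_real_Ioi_le (n : ℕ) {x : ℝ} (hx : 1 ≤ x) :
    (halfSignLaw n).real (Set.Ioi x) ≤ (gaussianReal 0 (n / 2 : NNReal)).real (Set.Ioi (x - 2)) := by
  have h1 := Nat.floor_le (show 0 ≤ x + 1 by linarith)
  have h2 := Nat.lt_floor_add_one (x + 1)
  rw [halfSignLaw_real_Ioi n ⌊x + 1⌋₊ h1 (by linarith)]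
  refine (centralTail_le_gaussianReal (Nat.le_floor (by push_cast; linarith))).trans ?_
  exact measureReal_mono (Set.Ioi_subset_Ioi (by linarith))

theorem le_halfSignLaw_real_Ioi {n : ℕ} (hn : 1 ≤ n) {x : ℝ} (hx : -1 ≤ x) (hxn : x + 1 ≤ n) :
    (gaussianReal 0 (n / 2 : NNReal)).real (Set.Ioi (shiftedPoint n (x + 1)))
      ≤ (halfSignLaw n).real (Set.Ioi x) := by
  have h0 : (0 : ℝ) ≤ x + 1 := by linarith
  have h1 := Nat.floor_le h0
  have h2 := Nat.lt_floor_add_one (x + 1)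
  rw [halfSignLaw_real_Ioi n ⌊x + 1⌋₊ h1 (by linarith)]
  refine le_trans ?_ (gaussianReal_le_centralTail hn (Nat.floor_le_of_le hxn))
  refine measureReal_mono (Set.Ioi_subset_Ioi ?_)
  unfold shiftedPoint
  gcongr

/-- The quantile coupling of half a sum of `2n` signs with a Gaussian variable of the same
variance `n / 2`. The error is quadratic in the standardised Gaussian variable, uniformly
in `n`. -/
theorem exists_halfSignLaw_coupling {n : ℕ} (hn : 1 ≤ n) :
    ∃ q : ℝ → ℝ, Measurable q ∧ (gaussianReal 0 (n / 2 : NNReal)).map q = halfSignLaw n ∧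
      ∀ g, |q g - g| ≤ 8 + 4 * g ^ 2 / n := by
  have hv : (n / 2 : NNReal) ≠ 0 := by
    have : n ≠ 0 := by omega
    positivity
  have hn' : (1 : ℝ) ≤ n := by exact_mod_cast hn
  have hs := strictMono_cdf_gaussianReal 0 hv
  obtain ⟨q, hq, hmap, hgal⟩ := exists_quantile_map (halfSignLaw n) (gaussianReal 0 (n / 2 : NNReal))
    (continuous_cdf_gaussianReal 0 hv) hs
  refine ⟨q, hq.measurable, hmap, ?_⟩
  set ρ := gaussianReal 0 (n / 2 : NNReal) with hρ
  have hsρ : ∀ x, ρ.real (Set.Iic (-x)) = ρ.real (Set.Ici x) :=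
    real_Iic_neg_of_map_neg (gaussianReal_map_neg_zero _)
  have hsμ : ∀ x, (halfSignLaw n).real (Set.Iic (-x)) = (halfSignLaw n).real (Set.Ici x) :=
    real_Iic_neg_of_map_neg (halfSignLaw_map_neg n)
  have hmono : ∀ {x y : ℝ}, x < y → ρ.real (Set.Iic x) < ρ.real (Set.Iic y) := by
    intro x y hxy
    rw [← cdf_eq_real, ← cdf_eq_real]
    exact hs hxy
  have hcompl : ∀ (κ : Measure ℝ) [IsProbabilityMeasure κ] (x : ℝ),
      κ.real (Set.Iic x) = 1 - κ.real (Set.Ioi x) := by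
    intro κ _ x
    rw [← Set.compl_Iic, probReal_compl_eq_one_sub measurableSet_Iic]
    ring
  -- Outward errors: the binomial tail is dominated by the shifted Gaussian tail.
  have hup : ∀ g, -1 ≤ g → q g ≤ g + 2 := by
    intro g hg
    rw [hgal, hcompl ρ, hcompl (halfSignLaw n)]
    have := halfSignLaw_real_Ioi_le n (x := g + 2) (by linarith)
    rw [show g + 2 - 2 = g by ring] at this
    linarith
  have hlow : ∀ g, g ≤ 1 → g - 3 ≤ q g := by
    intro g hg
    by_contra! hcon
    have h1 := (hgal g _).1 hcon.le
    rw [show g - 3 = -(3 - g) by ring, hsμ] at h1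
    have h2 : (halfSignLaw n).real (Set.Ici (3 - g))
        ≤ (halfSignLaw n).real (Set.Ioi (5 / 2 - g)) :=
      measureReal_mono (Set.Ici_subset_Ioi.2 (by linarith))
    have h3 := halfSignLaw_real_Ioi_le n (x := 5 / 2 - g) (by linarith)
    have h4 : ρ.real (Set.Ioi (5 / 2 - g - 2)) ≤ ρ.real (Set.Iic (g - 1 / 2)) := by
      rw [show g - 1 / 2 = -(1 / 2 - g) by ring, hsρ]
      refine measureReal_mono ?_
      rw [show 5 / 2 - g - 2 = 1 / 2 - g by ring]
      exact Set.Ioi_subset_Ici_self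
    have h5 := hmono (show g - 1 / 2 < g by linarith)
    linarith
  -- Inward errors: the binomial tail dominates the Gaussian tail at the shifted point.
  have hpt : ∀ g : ℝ, 0 ≤ g → -1 ≤ g - 6 - 4 * g ^ 2 / n → g - 6 - 4 * g ^ 2 / n + 1 ≤ n ∧
      shiftedPoint n (g - 6 - 4 * g ^ 2 / n + 1) < g := by
    intro g hg hx
    have hd : 0 ≤ 4 * g ^ 2 / n := by positivity
    have hgn : g - 4 * g ^ 2 / n ≤ n := by
      have : 4 * g ^ 2 / n = g + (4 * g ^ 2 - g * n) / n := by field_simp; ring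
      rw [this]
      have h : -(n : ℝ) ≤ (4 * g ^ 2 - g * n) / n := by
        rw [le_div_iff₀ (by linarith)]
        nlinarith [sq_nonneg (2 * g - n), sq_nonneg (g - n)]
      linarith
    refine ⟨by linarith, ?_⟩
    have : 4 * (g - 6 - 4 * g ^ 2 / n + 1) ^ 2 / n ≤ 4 * g ^ 2 / n := by
      gcongr
      · linarith
      · linarith
    unfold shiftedPoint
    linarith
  intro g
  have hd : 0 ≤ 4 * g ^ 2 / n := by positivity
  rw [abs_le]
  rcases le_total 0 g with hg | hg
  · refine ⟨?_, by linarith [hup g (by linarith)]⟩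
    rcases le_or_gt (-1) (g - 6 - 4 * g ^ 2 / n) with hx | hx
    · obtain ⟨ha, hb⟩ := hpt g hg hx
      have h1 := le_halfSignLaw_real_Ioi hn hx ha
      by_contra! hcon
      have h2 := (hgal g (g - 6 - 4 * g ^ 2 / n)).1 (by linarith)
      have h3 := hmono hb
      rw [hcompl ρ] at h2 h3
      rw [hcompl (halfSignLaw n)] at h2
      rw [hcompl ρ] at h3
      linarith
    · have := hlow 0 (by norm_num)
      have := hq hg
      linarith
  · refine ⟨by linarith [hlow g (by linarith)], ?_⟩
    obtain ⟨y, rfl⟩ : ∃ y, g = -y := ⟨-g, by ring⟩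
    rw [neg_sq] at hd ⊢
    rcases le_or_gt (-1) (y - 6 - 4 * y ^ 2 / n) with hx | hx
    · obtain ⟨ha, hb⟩ := hpt y (by linarith) hx
      have h1 := le_halfSignLaw_real_Ioi hn hx ha
      have h2 : q (-y) ≤ -(y - 6 - 4 * y ^ 2 / n) := by
        rw [hgal, hsρ, hsμ]
        refine le_trans ?_ (h1.trans (measureReal_mono Set.Ioi_subset_Ici_self))
        exact measureReal_mono (Set.Ici_subset_Ioi.2 hb)
      linarith
    · have := hup 0 (by norm_num)
      have := hq hg
      linarith

end SignSums

section SignSumCoupling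

theorem exists_even_sign_sum_coupling (n : ℕ) :
    ∃ q : ℝ → ℝ, Measurable q ∧
      (∀ t : ℝ, ∫ g, Complex.exp (t * q g * Complex.I) ∂(gaussianReal 0 1)
        = (Real.cos t : ℂ) ^ (2 * n)) ∧
      ∀ g, |q g - Real.sqrt ((2 * n : ℕ) : ℝ) * g| ≤ 16 * (1 + g ^ 2) := by
  rcases Nat.eq_zero_or_pos n with rfl | hn
  · refine ⟨fun _ => 0, measurable_const, by simp, fun g => ?_⟩
    simp
    positivity
  obtain ⟨q, hq, hmap, hbd⟩ := exists_halfSignLaw_coupling hn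
  have hn0 : (0 : ℝ) < n := by exact_mod_cast hn
  have hs : (Real.sqrt (n / 2)) ^ 2 = n / 2 := Real.sq_sqrt (by positivity)
  have hscale : (gaussianReal 0 1).map (fun g => Real.sqrt (n / 2) * g)
      = gaussianReal 0 (n / 2 : NNReal) := by
    rw [gaussianReal_map_const_mul, mul_zero]
    congr 1
    ext
    push_cast
    rw [hs, mul_one]
  refine ⟨fun g => 2 * q (Real.sqrt (n / 2) * g), by fun_prop, fun t => ?_, fun g => ?_⟩
  · rw [← charFun_halfSignLaw, charFun_apply_real, ← hmap, integral_map hq.aemeasurable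
      (by fun_prop), ← hscale, integral_map (by fun_prop)
      (by
        have : Measurable fun x => Complex.exp (↑(2 * t) * ↑(q x) * Complex.I) := by fun_prop
        exact this.aestronglyMeasurable)]
    refine integral_congr_ae (Filter.Eventually.of_forall fun g => ?_)
    simp only
    push_cast
    ring_nf
  · have h := hbd (Real.sqrt (n / 2) * g)
    have h2 : Real.sqrt ((2 * n : ℕ) : ℝ) = 2 * Real.sqrt (n / 2) := by
      rw [Real.sqrt_eq_iff_mul_self_eq (by positivity) (by positivity)]
      push_cast
      nlinarith
    rw [h2, mul_assoc, ← mul_sub, abs_mul, abs_two]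
    have h3 : 4 * (Real.sqrt (n / 2) * g) ^ 2 / n = 2 * g ^ 2 := by
      rw [mul_pow, hs]
      field_simp
      norm_num
    rw [h3] at h
    nlinarith [sq_nonneg g]

theorem integral_sign_gaussian (t : ℝ) :
    ∫ y : ℝ, Complex.exp (t * ((if 0 ≤ y then 1 else -1 : ℝ) : ℂ) * Complex.I) ∂(gaussianReal 0 1)
      = Real.cos t := by
  set f : ℝ → ℂ := fun y => Complex.exp (t * ((if 0 ≤ y then 1 else -1 : ℝ) : ℂ) * Complex.I)
    with hf
  have hm : Measurable f := by
    have : Measurable fun y : ℝ => (if 0 ≤ y then 1 else -1 : ℝ) :=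
      Measurable.ite measurableSet_Ici measurable_const measurable_const
    fun_prop
  have hi : Integrable f (gaussianReal 0 1) := by
    refine Integrable.of_bound hm.aestronglyMeasurable 1 (Filter.Eventually.of_forall fun y => ?_)
    rw [hf]
    simp only
    rw [← Complex.ofReal_mul, Complex.norm_exp_ofReal_mul_I]
  have hneg : ∫ y, f (-y) ∂(gaussianReal 0 1) = ∫ y, f y ∂(gaussianReal 0 1) := by
    conv_rhs => rw [← gaussianReal_map_neg_zero 1]
    rw [integral_map (by fun_prop) hm.aestronglyMeasurable]
  have hi' : Integrable (fun y => f (-y)) (gaussianReal 0 1) := by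
    have : Integrable f ((gaussianReal 0 1).map (fun x => -x)) := by
      rwa [gaussianReal_map_neg_zero 1]
    exact this.comp_measurable measurable_neg
  have hsum : ∫ y, (f y + f (-y)) ∂(gaussianReal 0 1) = 2 * Real.cos t := by
    have := nullSingletonClass_gaussianReal (μ := 0) (one_ne_zero (α := NNReal))
    have hae : ∀ᵐ y ∂(gaussianReal 0 1), y ≠ 0 := by
      rw [ae_iff]; simp
    rw [integral_congr_ae (g := fun _ => (2 * Real.cos t : ℂ))]
    · simp
    · filter_upwards [hae] with y hy
      rw [hf, Complex.ofReal_cos, Complex.cos]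
      rcases lt_or_gt_of_ne hy with h | h
      · simp [not_le.2 h, h.le]; ring
      · simp [not_le.2 h, h.le]; ring
  rw [integral_add hi hi', hneg, ← two_mul] at hsum
  exact mul_left_cancel₀ two_ne_zero hsum

/-- For every `M`, the sum of `M` random signs is realised as a function of two independent
standard Gaussian variables, at distance `O(1 + g²)` of `√M g`, where `g` is the first one. The
second one supplies the extra sign needed when `M` is odd. -/
theorem exists_sign_sum_coupling :
    ∃ Q : ℕ → ℝ × ℝ → ℝ, (∀ M, Measurable (Q M)) ∧
      (∀ (M : ℕ) (t : ℝ), ∫ z, Complex.exp (t * Q M z * Complex.I)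
        ∂((gaussianReal 0 1).prod (gaussianReal 0 1)) = (Real.cos t : ℂ) ^ M) ∧
      ∀ M z, |Q M z - Real.sqrt M * z.1| ≤ 18 * (1 + z.1 ^ 2) := by
  choose q hq hint hbd using exists_even_sign_sum_coupling
  set s : ℝ → ℝ := fun y => if 0 ≤ y then 1 else -1 with hs
  have hsm : Measurable s := Measurable.ite measurableSet_Ici measurable_const measurable_const
  refine ⟨fun M z => q (M / 2) z.1 + ((M % 2 : ℕ) : ℝ) * s z.2, fun M => ?_, fun M t => ?_,
    fun M z => ?_⟩
  · have := hq (M / 2)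
    fun_prop
  · have h := integral_prod_mul (μ := gaussianReal 0 1) (ν := gaussianReal 0 1)
      (fun g => Complex.exp (t * q (M / 2) g * Complex.I))
      (fun y => Complex.exp (((t * (M % 2 : ℕ) : ℝ) : ℂ) * s y * Complex.I))
    rw [hint, hs, integral_sign_gaussian] at h
    have hc : (Real.cos (t * (M % 2 : ℕ)) : ℂ) = (Real.cos t : ℂ) ^ (M % 2) := by
      rcases Nat.mod_two_eq_zero_or_one M with h | h <;> simp [h]
    rw [hc, ← pow_add, Nat.div_add_mod] at h
    rw [← h]
    refine integral_congr_ae (Filter.Eventually.of_forall fun z => ?_)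
    simp only [← Complex.exp_add]
    congr 1
    push_cast
    ring
  · have h := hbd (M / 2) z.1
    have h1 : |((M % 2 : ℕ) : ℝ) * s z.2| ≤ 1 := by
      have : |s z.2| = 1 := by
        simp only [hs]; split_ifs <;> simp
      rw [abs_mul, this, mul_one, Nat.abs_cast]
      exact_mod_cast (Nat.lt_succ_iff.1 (Nat.mod_lt M two_pos))
    have h2 : |Real.sqrt ((2 * (M / 2) : ℕ) : ℝ) - Real.sqrt M| ≤ 1 := by
      have ha : Real.sqrt ((2 * (M / 2) : ℕ) : ℝ) ≤ Real.sqrt M :=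
        Real.sqrt_le_sqrt (by exact_mod_cast Nat.mul_div_le M 2)
      have hb : Real.sqrt M ≤ Real.sqrt ((2 * (M / 2) : ℕ) : ℝ) + 1 := by
        rw [Real.sqrt_le_left (by positivity), add_sq,
          Real.sq_sqrt (by positivity)]
        have : M ≤ 2 * (M / 2) + 1 := by omega
        have : (M : ℝ) ≤ ((2 * (M / 2) : ℕ) : ℝ) + 1 := by exact_mod_cast this
        have := Real.sqrt_nonneg ((2 * (M / 2) : ℕ) : ℝ)
        linarith
      rw [abs_le]
      constructor <;> linarith
    have h3 : |z.1| ≤ 1 + z.1 ^ 2 := by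
      rw [← sq_abs]; nlinarith [sq_nonneg (|z.1| - 1), abs_nonneg z.1]
    calc |q (M / 2) z.1 + ((M % 2 : ℕ) : ℝ) * s z.2 - Real.sqrt M * z.1|
        = |(q (M / 2) z.1 - Real.sqrt ((2 * (M / 2) : ℕ) : ℝ) * z.1)
          + ((M % 2 : ℕ) : ℝ) * s z.2
          + (Real.sqrt ((2 * (M / 2) : ℕ) : ℝ) - Real.sqrt M) * z.1| := by
          congr 1; ring
      _ ≤ 16 * (1 + z.1 ^ 2) + 1 + 1 * |z.1| := by
          refine (abs_add_le _ _).trans (add_le_add ((abs_add_le _ _).trans (add_le_add h h1)) ?_)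
          rw [abs_mul]
          gcongr
      _ ≤ _ := by nlinarith [sq_nonneg z.1]

end SignSumCoupling

/-! ### Averages over the symmetric group -/

section PermAverages

open Finset Equiv

/-- Hoeffding's lemma for a uniform average over a finite type. -/
theorem sum_exp_le_of_abs_le {ι : Type*} [Fintype ι] {x : ι → ℝ} {b : ℝ} (hx : ∑ i, x i = 0)
    (hb : ∀ i, |x i| ≤ b) (t : ℝ) :
    ∑ i, Real.exp (t * x i) ≤ Fintype.card ι * Real.exp (t ^ 2 * b ^ 2 / 2) := by
  rcases le_or_gt b 0 with h0 | h0
  · have : ∀ i, x i = 0 := fun i => abs_nonpos_iff.1 ((hb i).trans h0)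
    simp only [this, mul_zero, Real.exp_zero, sum_const, card_univ, nsmul_eq_mul]
    gcongr
    exact Real.one_le_exp (by positivity)
  have hconv : ∀ i, Real.exp (t * x i)
      ≤ Real.cosh (t * b) + x i * (Real.sinh (t * b) / b) := by
    intro i
    obtain ⟨h1, h2⟩ := abs_le.1 (hb i)
    have h := convexOn_exp.2 (Set.mem_univ (t * b)) (Set.mem_univ (-(t * b)))
      (show 0 ≤ (b + x i) / (2 * b) from div_nonneg (by linarith) (by linarith))
      (show 0 ≤ (b - x i) / (2 * b) from div_nonneg (by linarith) (by linarith))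
      (by field_simp; ring)
    simp only [smul_eq_mul] at h
    have e : (b + x i) / (2 * b) * (t * b) + (b - x i) / (2 * b) * -(t * b) = t * x i := by
      field_simp; ring
    rw [e] at h
    refine h.trans (le_of_eq ?_)
    rw [Real.cosh_eq, Real.sinh_eq]
    field_simp
    ring
  calc ∑ i, Real.exp (t * x i)
      ≤ ∑ i, (Real.cosh (t * b) + x i * (Real.sinh (t * b) / b)) := sum_le_sum fun i _ => hconv i
    _ = Fintype.card ι * Real.cosh (t * b) := by
        rw [sum_add_distrib, ← sum_mul, hx]
        simp
    _ ≤ _ := by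
        gcongr
        refine (Real.cosh_le_exp_half_sq _).trans (le_of_eq ?_)
        ring_nf

/-- A function on permutations that moves by at most `c` under each transposition is
sub-Gaussian, with variance proxy of order `n c²`. The induction reveals the image of `0`. -/
theorem sum_exp_perm_le (n : ℕ) {c : ℝ} (f : Perm (Fin n) → ℝ)
    (hf : ∀ π a b, |f (π * swap a b) - f π| ≤ c) {m : ℝ}
    (hm : ∑ π, f π = Fintype.card (Perm (Fin n)) * m) (t : ℝ) :
    ∑ π, Real.exp (t * (f π - m))
      ≤ Fintype.card (Perm (Fin n)) * Real.exp (n * (2 * c ^ 2 * t ^ 2)) := by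
  induction n generalizing m with
  | zero =>
    have : ∀ π, f π = m := by
      intro π
      have h := hm
      rw [Fintype.sum_eq_single π (fun x hx => absurd (Subsingleton.elim x π) hx)] at h
      rw [h]
      simp
    simp [this]
  | succ n ih =>
    set F : Fin (n + 1) → Perm (Fin n) → ℝ := fun p e => f (Perm.decomposeFin.symm (p, e)) with hF
    set N : ℝ := (Fintype.card (Perm (Fin n)) : ℝ) with hN
    have hNpos : 0 < N := by rw [hN]; exact_mod_cast Fintype.card_pos
    have hcard : (Fintype.card (Perm (Fin (n + 1))) : ℝ) = (n + 1) * N := by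
      rw [hN, Fintype.card_congr Perm.decomposeFin, Fintype.card_prod, Fintype.card_fin]
      push_cast
      ring
    have hsum : ∀ g : Perm (Fin (n + 1)) → ℝ,
        ∑ π, g π = ∑ p, ∑ e, g (Perm.decomposeFin.symm (p, e)) := by
      intro g
      rw [← (Perm.decomposeFin (n := n)).symm.sum_comp, Fintype.sum_prod_type]
    have hswap : ∀ (p : Fin (n + 1)) (e : Perm (Fin n)) (a b : Fin n),
        Perm.decomposeFin.symm (p, e * swap a b)
          = Perm.decomposeFin.symm (p, e) * swap a.succ b.succ := by
      intro p e a b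
      ext x
      refine Fin.cases ?_ (fun y => ?_) x
      · rw [Perm.mul_apply, swap_apply_of_ne_of_ne (Fin.succ_ne_zero a).symm
          (Fin.succ_ne_zero b).symm]
        simp
      · rw [Perm.mul_apply, (Fin.succ_injective n).swap_apply]
        simp
    have hleft : ∀ (p : Fin (n + 1)) (e : Perm (Fin n)), |F p e - F 0 e| ≤ c := by
      intro p e
      have h0 : Perm.decomposeFin.symm (p, e)
          = Perm.decomposeFin.symm (0, e) * swap ((Perm.decomposeFin.symm (0, e))⁻¹ 0)
            ((Perm.decomposeFin.symm (0, e))⁻¹ p) := by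
        have h1 : Perm.decomposeFin.symm (p, e) = swap 0 p * Perm.decomposeFin.symm (0, e) := by
          ext x
          refine Fin.cases ?_ (fun y => ?_) x <;> simp
        rw [h1]
        exact (Equiv.swap_mul_eq_mul_swap _ _ _)
      simp only [hF]
      rw [h0]
      exact hf _ _ _
    set M : Fin (n + 1) → ℝ := fun p => (∑ e, F p e) / N with hM
    have hMsum : ∀ p, ∑ e, F p e = N * M p := fun p => by rw [hM]; field_simp
    have hM0 : ∀ p, |M p - M 0| ≤ c := by
      intro p
      have : M p - M 0 = (∑ e, (F p e - F 0 e)) / N := by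
        rw [sum_sub_distrib, sub_div]
      rw [this, abs_div, abs_of_pos hNpos, div_le_iff₀ hNpos]
      calc |∑ e, (F p e - F 0 e)| ≤ ∑ e, |F p e - F 0 e| := abs_sum_le_sum_abs _ _
        _ ≤ ∑ _e : Perm (Fin n), c := sum_le_sum fun e _ => hleft p e
        _ = c * N := by simp [hN, mul_comm]
    have hmM : ∑ p, M p = (n + 1) * m := by
      have h := hm
      rw [hsum, hcard] at h
      have h2 : ∑ p, ∑ e, f (Perm.decomposeFin.symm (p, e)) = N * ∑ p, M p := by
        rw [mul_sum]
        exact sum_congr rfl fun p _ => hMsum p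
      rw [h2] at h
      apply mul_left_cancel₀ hNpos.ne'
      rw [h]; ring
    have hn1 : (0 : ℝ) < n + 1 := by positivity
    have hmM0 : |m - M 0| ≤ c := by
      have : m - M 0 = (∑ p, (M p - M 0)) / (n + 1) := by
        rw [sum_sub_distrib, hmM]
        simp
        field_simp
      rw [this, abs_div, abs_of_pos hn1, div_le_iff₀ hn1]
      calc |∑ p, (M p - M 0)| ≤ ∑ p, |M p - M 0| := abs_sum_le_sum_abs _ _
        _ ≤ ∑ _p : Fin (n + 1), c := sum_le_sum fun p _ => hM0 p
        _ = c * (n + 1) := by simp [mul_comm]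
    have hMm : ∀ p, |M p - m| ≤ 2 * c := by
      intro p
      have := abs_sub_le (M p) (M 0) m
      rw [abs_sub_comm (M 0) m] at this
      linarith [hM0 p]
    have hHoeff := sum_exp_le_of_abs_le (x := fun p => M p - m)
      (by rw [sum_sub_distrib, hmM]; simp) hMm t
    rw [hsum, hcard]
    calc ∑ p, ∑ e, Real.exp (t * (f (Perm.decomposeFin.symm (p, e)) - m))
        = ∑ p, Real.exp (t * (M p - m)) * ∑ e, Real.exp (t * (F p e - M p)) := by
          refine sum_congr rfl fun p _ => ?_
          rw [mul_sum]
          refine sum_congr rfl fun e _ => ?_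
          rw [← Real.exp_add]
          congr 1
          simp only [hF]
          ring
      _ ≤ ∑ p, Real.exp (t * (M p - m)) * (N * Real.exp (n * (2 * c ^ 2 * t ^ 2))) := by
          gcongr with p
          refine ih (F p) (fun e a b => ?_) (hMsum p)
          simp only [hF]
          rw [hswap]
          exact hf _ _ _
      _ ≤ ((n + 1) * Real.exp (t ^ 2 * (2 * c) ^ 2 / 2))
            * (N * Real.exp (n * (2 * c ^ 2 * t ^ 2))) := by
          rw [← sum_mul]
          gcongr
          simpa using hHoeff
      _ = _ := by
          rw [mul_mul_mul_comm, ← Real.exp_add]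
          congr 2
          push_cast
          ring

/-- Sub-Gaussian variables have a uniformly bounded exponential moment of their square: write
`exp (h² x² / 2)` as the moment generating function of a standard Gaussian variable at `h x` and
exchange the two averages. -/
theorem sum_exp_sq_le {ι : Type*} [Fintype ι] {X : ι → ℝ} {A : ℝ} (hA : 0 < A)
    (hX : ∀ s : ℝ, ∑ i, Real.exp (s * X i) ≤ Fintype.card ι * Real.exp (A * s ^ 2)) :
    ∑ i, Real.exp (X i ^ 2 / (8 * A)) ≤ Fintype.card ι * Real.sqrt 2 := by
  set h : ℝ := Real.sqrt (1 / (4 * A)) with hh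
  have hsq : h ^ 2 = 1 / (4 * A) := Real.sq_sqrt (by positivity)
  have hint : ∀ i, Integrable (fun g : ℝ => Real.exp (g * h * X i)) (gaussianReal 0 1) := by
    intro i
    have := integrable_exp_mul_gaussianReal (μ := 0) (v := 1) (h * X i)
    refine this.congr (Filter.Eventually.of_forall fun g => ?_)
    simp only
    ring_nf
  calc ∑ i, Real.exp (X i ^ 2 / (8 * A))
      = ∑ i, ∫ g : ℝ, Real.exp (g * h * X i) ∂(gaussianReal 0 1) := by
        refine sum_congr rfl fun i _ => ?_
        have hmgf := congrFun (mgf_id_gaussianReal (μ := 0) (v := 1)) (h * X i)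
        simp only [mgf, id] at hmgf
        rw [show (fun g : ℝ => Real.exp (g * h * X i)) = fun g => Real.exp (h * X i * g) by
          funext g; ring_nf, hmgf]
        congr 1
        rw [mul_pow, hsq]
        push_cast
        field_simp
        ring
    _ = ∫ g : ℝ, ∑ i, Real.exp (g * h * X i) ∂(gaussianReal 0 1) :=
        (integral_finsetSum _ fun i _ => hint i).symm
    _ ≤ ∫ g : ℝ, Fintype.card ι * Real.exp (g ^ 2 / 4) ∂(gaussianReal 0 1) := by
        refine integral_mono (integrable_finsetSum _ fun i _ => hint i)
          (integrable_exp_sq_div_four.const_mul _) fun g => ?_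
        refine (hX (g * h)).trans (le_of_eq ?_)
        rw [mul_pow, hsq]
        congr 2
        field_simp
    _ = _ := by rw [integral_const_mul, integral_exp_sq_div_four]

theorem exists_perm_apply_pair {α : Type*} [DecidableEq α] {i j i' j' : α} (h : i ≠ j)
    (h' : i' ≠ j') : ∃ τ : Perm α, τ i = i' ∧ τ j = j' := by
  refine ⟨swap (swap i i' j) j' * swap i i', ?_, by simp⟩
  have hk : i' ≠ swap i i' j := by
    intro hk
    have : swap i i' i' = j := by rw [swap_apply_eq_iff.2 hk]
    rw [swap_apply_right] at this
    exact h this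
  simp [swap_apply_of_ne_of_ne hk h']

/-- Under a uniform permutation the images of two distinct points form a uniform pair of
distinct points. -/
theorem sum_perm_pair {n : ℕ} (F : Fin n → Fin n → ℝ) (hF : ∀ a, F a a = 0) {i j : Fin n}
    (hij : i ≠ j) :
    (n * (n - 1) : ℝ) * ∑ π : Perm (Fin n), F (π i) (π j)
      = Fintype.card (Perm (Fin n)) * ∑ a, ∑ b, F a b := by
  have hinv : ∀ a b : Fin n, a ≠ b →
      ∑ π : Perm (Fin n), F (π a) (π b) = ∑ π : Perm (Fin n), F (π i) (π j) := by
    intro a b hab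
    obtain ⟨τ, h1, h2⟩ := exists_perm_apply_pair hij hab
    rw [← Equiv.sum_comp (Equiv.mulRight τ) (fun π : Perm (Fin n) => F (π i) (π j))]
    simp [h1, h2]
  have htot : ∀ π : Perm (Fin n), ∑ a, ∑ b, F (π a) (π b) = ∑ a, ∑ b, F a b := by
    intro π
    refine Eq.trans (sum_congr rfl fun a _ => ?_) (Equiv.sum_comp π fun a => ∑ b, F a b)
    exact Equiv.sum_comp π (fun b => F (π a) b)
  have hleft : ∑ a : Fin n, ∑ b : Fin n, ∑ π : Perm (Fin n), F (π a) (π b)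
      = (n * (n - 1) : ℝ) * ∑ π : Perm (Fin n), F (π i) (π j) := by
    have : ∀ a : Fin n, ∑ b : Fin n, ∑ π : Perm (Fin n), F (π a) (π b)
        = (n - 1 : ℝ) * ∑ π : Perm (Fin n), F (π i) (π j) := by
      intro a
      rw [← add_sum_erase _ _ (mem_univ a)]
      rw [sum_eq_zero (fun π _ => hF _), zero_add, sum_congr rfl
        (fun b hb => hinv a b (ne_of_mem_erase hb).symm), sum_const, card_erase_of_mem (mem_univ a),
        card_univ, Fintype.card_fin, nsmul_eq_mul, Nat.cast_sub (by have := a.2; omega)]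
      simp
    rw [sum_congr rfl fun a _ => this a]
    simp
    ring
  rw [← hleft]
  rw [sum_congr rfl fun a _ => sum_comm, sum_comm, sum_congr rfl fun π _ => htot π]
  simp

end PermAverages

/-! ### The bridge as a sum of pair differences with random signs -/

section Pairing

open Finset Equiv PermWalk

/-- Symmetrisation over finitely many commuting sign flips: if `τ i` flips the sign of `d i` and
fixes everything else, each phase `exp (i d i)` may be replaced by its average `cos (d i)`. -/
theorem sum_mul_prod_exp_eq_sum_mul_prod_cos {X ι : Type*} [Fintype X] [DecidableEq ι]
    (Q : Finset ι) (τ : ι → Perm X) (d : ι → X → ℝ)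
    (hd : ∀ i ∈ Q, ∀ x, d i (τ i x) = -d i x)
    (hd' : ∀ i ∈ Q, ∀ j ∈ Q, j ≠ i → ∀ x, d j (τ i x) = d j x)
    (f : X → ℂ) (hf : ∀ i ∈ Q, ∀ x, f (τ i x) = f x) :
    ∑ x, f x * ∏ i ∈ Q, Complex.exp (d i x * Complex.I)
      = ∑ x, f x * ∏ i ∈ Q, (Real.cos (d i x) : ℂ) := by
  induction Q using Finset.induction_on generalizing f with
  | empty => simp
  | insert i Q hi ih =>
    simp only [prod_insert hi]
    have hne : ∀ j ∈ Q, j ≠ i := fun j hj h => hi (h ▸ hj)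
    have h1 := ih (fun j hj => hd j (mem_insert_of_mem hj))
      (fun j hj l hl => hd' j (mem_insert_of_mem hj) l (mem_insert_of_mem hl))
      (fun x => f x * Complex.exp (d i x * Complex.I))
      (fun j hj x => by
        rw [hf j (mem_insert_of_mem hj),
          hd' j (mem_insert_of_mem hj) i (mem_insert_self _ _) (hne j hj).symm])
    simp only [mul_assoc] at h1
    rw [h1]
    have hprod : ∀ x, ∏ j ∈ Q, (Real.cos (d j (τ i x)) : ℂ) = ∏ j ∈ Q, (Real.cos (d j x) : ℂ) :=
      fun x => prod_congr rfl fun j hj => by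
        rw [hd' i (mem_insert_self _ _) j (mem_insert_of_mem hj) (hne j hj)]
    have h2 : ∑ x, f x * (Complex.exp (d i x * Complex.I) * ∏ j ∈ Q, (Real.cos (d j x) : ℂ))
        = ∑ x, f x * (Complex.exp (-d i x * Complex.I) * ∏ j ∈ Q, (Real.cos (d j x) : ℂ)) := by
      rw [← Equiv.sum_comp (τ i)]
      refine sum_congr rfl fun x _ => ?_
      rw [hf i (mem_insert_self _ _), hd i (mem_insert_self _ _), hprod]
      push_cast
      rfl
    refine mul_left_cancel₀ (two_ne_zero (α := ℂ)) ?_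
    conv_lhs => rw [two_mul]; arg 2; rw [h2]
    rw [← sum_add_distrib, mul_sum]
    refine sum_congr rfl fun x _ => ?_
    rw [Complex.ofReal_cos, Complex.cos]
    ring

/-- The positions `i` in the smaller of the two halves `{i | i < k}`, `{i | k ≤ i}`, reflected to
the left if necessary; `i` is paired with `i.rev`. When `n` is odd the middle position is left
unpaired. -/
def leftHalf (n k : ℕ) : Finset (Fin n) := univ.filter fun i => i.val < min k (n - k)

/-- Half the difference of the entries at the positions `i` and `i.rev`. -/
noncomputable def halfDiff {n : ℕ} (ε : Fin n → ℝ) (π : Perm (Fin n)) (i : Fin n) : ℝ :=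
  (ε (π i) - ε (π i.rev)) / 2

/-- The conditional variance of the bridge when only the unordered pairs of entries at the
positions `i`, `i.rev` are known. -/
noncomputable def pairVariance {n : ℕ} (ε : Fin n → ℝ) (k : ℕ) (π : Perm (Fin n)) : ℝ :=
  ∑ i ∈ leftHalf n k, halfDiff ε π i ^ 2

/-- The part of the bridge that depends only on the unordered pairs of entries. -/
noncomputable def pairCenter {n : ℕ} (ε : Fin n → ℝ) (k : ℕ) (π : Perm (Fin n)) : ℝ :=
  bridge ε k π - ∑ i ∈ leftHalf n k, halfDiff ε π i

theorem mem_leftHalf {n k : ℕ} {i : Fin n} : i ∈ leftHalf n k ↔ i.val < min k (n - k) := by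
  simp [leftHalf]

theorem card_leftHalf (n k : ℕ) : (leftHalf n k).card = min k (n - k) := by
  unfold leftHalf
  rw [Fin.card_filter_val_lt]
  omega

/-- The coefficients of `pairCenter` as a linear function of the permuted entries. -/
noncomputable def centerCoeff (n k : ℕ) (i : Fin n) : ℝ :=
  (if i.val < k then 1 else 0) - k / n
    - ((if i ∈ leftHalf n k then 1 else 0) - (if i.rev ∈ leftHalf n k then 1 else 0)) / 2

theorem pairCenter_eq {n : ℕ} (ε : Fin n → ℝ) (k : ℕ) (π : Perm (Fin n)) :
    pairCenter ε k π = ∑ i, centerCoeff n k i * ε (π i) := by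
  unfold pairCenter centerCoeff bridge halfDiff
  rw [partialSum_self]
  have h1 : partialSum ε π k = ∑ i : Fin n, (if i.val < k then 1 else 0) * ε (π i) := by
    unfold partialSum
    rw [sum_filter]
    exact sum_congr rfl fun i _ => by split_ifs <;> simp
  have h2 : total ε = ∑ i : Fin n, ε (π i) := (Equiv.sum_comp π ε).symm
  have h3 : ∀ f : Fin n → ℝ, ∑ i ∈ leftHalf n k, f i
      = ∑ i : Fin n, (if i ∈ leftHalf n k then 1 else 0) * f i := by
    intro f
    simp
  have h4 : ∑ i : Fin n, (if i ∈ leftHalf n k then (1 : ℝ) else 0) * ε (π i.rev)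
      = ∑ i : Fin n, (if i.rev ∈ leftHalf n k then (1 : ℝ) else 0) * ε (π i) := by
    rw [← Equiv.sum_comp Fin.revPerm]
    simp
  rw [h1, h2, ← sum_div, h3]
  simp only [mul_sub, sum_sub_distrib, sub_mul, sub_div, div_mul_eq_mul_div]
  rw [h4, ← sum_div, ← sum_div, mul_sum, ← sum_div]

theorem centerCoeff_of_paired {n k : ℕ} {i : Fin n}
    (hi : i ∈ leftHalf n k ∨ i.rev ∈ leftHalf n k) : centerCoeff n k i = 1 / 2 - k / n := by
  have hin := i.2
  have hrev := Fin.val_rev i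
  unfold centerCoeff
  simp only [mem_leftHalf, hrev] at hi ⊢
  rcases hi with hi | hi
  · rw [if_pos (by omega), if_pos hi, if_neg (by omega)]
    ring
  · rw [if_neg (by omega), if_neg (by omega), if_pos hi]
    ring

theorem abs_two_mul_sub_le {n k : ℕ} (hk : |2 * (k : ℤ) - (n : ℤ)| ≤ 1) :
    2 * k ≤ n + 1 ∧ n ≤ 2 * k + 1 := by
  rw [abs_le] at hk
  omega

theorem abs_centerCoeff_le {n k : ℕ} (hk : |2 * (k : ℤ) - (n : ℤ)| ≤ 1) (i : Fin n) :
    |centerCoeff n k i| ≤ 1 / n + if i.val = min k (n - k) then 1 else 0 := by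
  obtain ⟨h1, h2⟩ := abs_two_mul_sub_le hk
  have hin := i.2
  have hrev := Fin.val_rev i
  have hn : (0 : ℝ) < n := by
    have : 0 < n := by omega
    exact_mod_cast this
  by_cases hi : i ∈ leftHalf n k ∨ i.rev ∈ leftHalf n k
  · rw [centerCoeff_of_paired hi]
    have h3 : |(1 : ℝ) / 2 - k / n| ≤ 1 / n := by
      have e : (1 : ℝ) / 2 - k / n = (n - 2 * k) / 2 / n := by field_simp
      rw [e, abs_div, abs_of_pos hn]
      gcongr
      have h1' : (2 * k : ℝ) ≤ n + 1 := by exact_mod_cast h1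
      have h2' : (n : ℝ) ≤ 2 * k + 1 := by exact_mod_cast h2
      rw [abs_le]
      constructor <;> linarith
    refine h3.trans (le_add_of_nonneg_right ?_)
    split_ifs <;> norm_num
  · obtain ⟨ha, hb⟩ := not_or.1 hi
    have hm : i.val = min k (n - k) := by
      simp only [mem_leftHalf, hrev] at ha hb
      omega
    rw [if_pos hm]
    unfold centerCoeff
    rw [if_neg ha, if_neg hb]
    have h3 : (k : ℝ) / n ≤ 1 + 1 / n := by
      rw [← sub_nonneg]
      have : (k : ℝ) ≤ n + 1 := by
        have : k ≤ n + 1 := by omega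
        exact_mod_cast this
      have e : 1 + 1 / (n : ℝ) - k / n = (n + 1 - k) / n := by field_simp
      rw [e]
      apply div_nonneg <;> linarith
    have h4 : (0 : ℝ) ≤ k / n := by positivity
    have h5 : (0 : ℝ) ≤ 1 / n := by positivity
    rw [abs_le]
    split_ifs <;> constructor <;> linarith

theorem abs_pairCenter_le {n k : ℕ} (hk : |2 * (k : ℤ) - (n : ℤ)| ≤ 1) {ε : Fin n → ℝ} {B : ℝ}
    (hB : 0 ≤ B) (hε : ∀ i, |ε i| ≤ B) (π : Perm (Fin n)) : |pairCenter ε k π| ≤ 2 * B := by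
  rw [pairCenter_eq]
  calc |∑ i, centerCoeff n k i * ε (π i)|
      ≤ ∑ i, |centerCoeff n k i * ε (π i)| := abs_sum_le_sum_abs _ _
    _ ≤ ∑ i : Fin n, (1 / n + if i.val = min k (n - k) then 1 else 0) * B := by
        refine sum_le_sum fun i _ => ?_
        rw [abs_mul]
        exact mul_le_mul (abs_centerCoeff_le hk i) (hε _) (abs_nonneg _)
          ((abs_nonneg _).trans (abs_centerCoeff_le hk i))
    _ ≤ (1 + 1) * B := by
        rw [← sum_mul, sum_add_distrib]
        gcongr
        · simp only [sum_const, card_univ, Fintype.card_fin, nsmul_eq_mul]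
          rw [mul_one_div]
          exact div_self_le_one _
        · rw [sum_boole]
          norm_cast
          refine card_le_one.2 fun a ha b hb => Fin.ext ?_
          simp only [mem_filter, mem_univ, true_and] at ha hb
          rw [ha, hb]
    _ = _ := by ring

/-- The action on permutations that exchanges the entries at the positions `i` and `i.rev`. -/
def pairSwap {n : ℕ} (i : Fin n) : Perm (Perm (Fin n)) := Equiv.mulRight (swap i i.rev)

theorem pairSwap_apply {n : ℕ} (i : Fin n) (π : Perm (Fin n)) (j : Fin n) :
    pairSwap i π j = π (swap i i.rev j) := rfl

theorem halfDiff_pairSwap_self {n : ℕ} (ε : Fin n → ℝ) (π : Perm (Fin n)) (i : Fin n) :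
    halfDiff ε (pairSwap i π) i = -halfDiff ε π i := by
  unfold halfDiff
  simp only [pairSwap_apply, swap_apply_left, swap_apply_right]
  ring

theorem halfDiff_pairSwap_of_ne {n k : ℕ} (ε : Fin n → ℝ) (π : Perm (Fin n)) {i j : Fin n}
    (hi : i ∈ leftHalf n k) (hj : j ∈ leftHalf n k) (hij : j ≠ i) :
    halfDiff ε (pairSwap i π) j = halfDiff ε π j := by
  have hrev : ∀ a : Fin n, a ∈ leftHalf n k → ∀ b ∈ leftHalf n k, a ≠ b.rev := by
    intro a ha b hb h
    have hb2 := b.2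
    rw [h] at ha
    rw [mem_leftHalf, Fin.val_rev] at ha
    rw [mem_leftHalf] at hb
    omega
  unfold halfDiff
  simp only [pairSwap_apply]
  rw [swap_apply_of_ne_of_ne hij (hrev j hj i hi), swap_apply_of_ne_of_ne (hrev i hi j hj).symm
    (fun h => hij (Fin.rev_injective h))]

theorem pairCenter_pairSwap {n k : ℕ} (ε : Fin n → ℝ) (π : Perm (Fin n)) {i : Fin n}
    (hi : i ∈ leftHalf n k) : pairCenter ε k (pairSwap i π) = pairCenter ε k π := by
  rw [pairCenter_eq, pairCenter_eq, ← Equiv.sum_comp (swap i i.rev)]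
  refine sum_congr rfl fun j _ => ?_
  rw [pairSwap_apply, swap_apply_self]
  congr 1
  have h1 : centerCoeff n k i.rev = centerCoeff n k i := by
    rw [centerCoeff_of_paired (Or.inl hi), centerCoeff_of_paired (Or.inr (by simpa using hi))]
  rw [swap_apply_def]
  split_ifs with ha hb
  · rw [ha, h1]
  · rw [hb, h1]
  · rfl

theorem integral_uniformOfFintype {X E : Type*} [Fintype X] [Nonempty X] [MeasurableSpace X]
    [MeasurableSingletonClass X] [NormedAddCommGroup E] [NormedSpace ℝ E] [CompleteSpace E]
    (g : X → E) :
    ∫ x, g x ∂(PMF.uniformOfFintype X).toMeasure = (Fintype.card X : ℝ)⁻¹ • ∑ x, g x := by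
  rw [PMF.integral_eq_sum, smul_sum]
  simp

/-- Flipping each pair independently does not change the law of a uniform permutation, so the
characteristic function of the bridge is an average of products of cosines. -/
theorem charFun_bridgeLaw {n : ℕ} (ε : Fin n → ℝ) (k : ℕ) (t : ℝ) :
    charFun (bridgeLaw ε k) t = (Fintype.card (Perm (Fin n)) : ℝ)⁻¹ •
      ∑ π : Perm (Fin n), Complex.exp (t * pairCenter ε k π * Complex.I) *
        ∏ i ∈ leftHalf n k, (Real.cos (t * halfDiff ε π i) : ℂ) := by
  let _ : MeasurableSpace (Perm (Fin n)) := ⊤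
  have hm : Measurable (bridge ε k) := measurable_from_top
  unfold bridgeLaw
  rw [← PMF.toMeasure_map _ _ hm, charFun_apply_real, integral_map hm.aemeasurable (by fun_prop),
    integral_uniformOfFintype]
  congr 1
  rw [← sum_mul_prod_exp_eq_sum_mul_prod_cos (leftHalf n k) pairSwap
    (fun i π => t * halfDiff ε π i)
    (fun i _ π => by rw [halfDiff_pairSwap_self]; ring)
    (fun i hi j hj hij π => by rw [halfDiff_pairSwap_of_ne ε π hi hj hij])
    (fun π => Complex.exp (t * pairCenter ε k π * Complex.I))
    (fun i hi π => by rw [pairCenter_pairSwap ε π hi])]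
  refine sum_congr rfl fun π _ => ?_
  rw [← Complex.exp_sum, ← Complex.exp_add]
  congr 1
  have : bridge ε k π = pairCenter ε k π + ∑ i ∈ leftHalf n k, halfDiff ε π i := by
    unfold pairCenter; ring
  rw [this]
  push_cast
  rw [mul_add, add_mul, mul_sum, sum_mul]

end Pairing

/-! ### Concentration of the pair variance -/

section PairVariance

open Finset Equiv PermWalk

theorem sq_halfDiff_le {n : ℕ} {ε : Fin n → ℝ} {B : ℝ} (hε : ∀ i, |ε i| ≤ B)
    (π : Perm (Fin n)) (i : Fin n) : halfDiff ε π i ^ 2 ≤ B ^ 2 := by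
  apply sq_le_sq'
  all_goals
    unfold halfDiff
    have h1 := abs_le.1 (hε (π i))
    have h2 := abs_le.1 (hε (π i.rev))
    linarith [h1.1, h1.2, h2.1, h2.2]

theorem abs_pairVariance_mul_swap_sub_le {n : ℕ} (k : ℕ) {ε : Fin n → ℝ} {B : ℝ}
    (hε : ∀ i, |ε i| ≤ B) (π : Perm (Fin n)) (a b : Fin n) :
    |pairVariance ε k (π * swap a b) - pairVariance ε k π| ≤ 4 * B ^ 2 := by
  unfold pairVariance
  rw [← sum_sub_distrib]
  have hterm : ∀ i : Fin n, |halfDiff ε (π * swap a b) i ^ 2 - halfDiff ε π i ^ 2|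
      ≤ ((if i = a then 1 else 0) + (if i = b then 1 else 0)
        + (if i = a.rev then 1 else 0) + (if i = b.rev then 1 else 0)) * B ^ 2 := by
    intro i
    have h0 : |halfDiff ε (π * swap a b) i ^ 2 - halfDiff ε π i ^ 2| ≤ B ^ 2 := by
      rw [abs_le]
      constructor <;> linarith [sq_halfDiff_le hε (π * swap a b) i, sq_halfDiff_le hε π i,
        sq_nonneg (halfDiff ε (π * swap a b) i), sq_nonneg (halfDiff ε π i)]
    by_cases h : i = a ∨ i = b ∨ i = a.rev ∨ i = b.rev
    · refine h0.trans (le_mul_of_one_le_left (sq_nonneg B) ?_)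
      rcases h with h | h | h | h
      all_goals
        rw [if_pos h]
        split_ifs <;> norm_num
    · simp only [not_or] at h
      obtain ⟨h1, h2, h3, h4⟩ := h
      have hra : i.rev ≠ a := fun h => h3 (by rw [← h, Fin.rev_rev])
      have hrb : i.rev ≠ b := fun h => h4 (by rw [← h, Fin.rev_rev])
      have : halfDiff ε (π * swap a b) i = halfDiff ε π i := by
        unfold halfDiff
        rw [Perm.mul_apply, Perm.mul_apply, swap_apply_of_ne_of_ne h1 h2,
          swap_apply_of_ne_of_ne hra hrb]
      simp [this, h1, h2, h3, h4]
  calc _ ≤ ∑ i ∈ leftHalf n k, |halfDiff ε (π * swap a b) i ^ 2 - halfDiff ε π i ^ 2| :=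
        abs_sum_le_sum_abs _ _
    _ ≤ ∑ i : Fin n, |halfDiff ε (π * swap a b) i ^ 2 - halfDiff ε π i ^ 2| :=
        sum_le_sum_of_subset_of_nonneg (subset_univ _) fun _ _ _ => abs_nonneg _
    _ ≤ _ := sum_le_sum fun i _ => hterm i
    _ = 4 * B ^ 2 := by
        rw [← sum_mul]
        simp only [sum_add_distrib, sum_ite_eq', mem_univ, if_true]
        norm_num

theorem sum_exp_sq_pairVariance_le {n : ℕ} (hn : 1 ≤ n) (k : ℕ) {ε : Fin n → ℝ} {B : ℝ}
    (hB : 0 < B) (hε : ∀ i, |ε i| ≤ B) {m : ℝ}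
    (hm : ∑ π, pairVariance ε k π = Fintype.card (Perm (Fin n)) * m) :
    ∑ π, Real.exp ((pairVariance ε k π - m) ^ 2 / (256 * n * B ^ 4))
      ≤ Fintype.card (Perm (Fin n)) * Real.sqrt 2 := by
  have hn' : (0 : ℝ) < n := by exact_mod_cast hn
  have h := sum_exp_sq_le (X := fun π => pairVariance ε k π - m) (A := 32 * n * B ^ 4)
    (by positivity) (fun s => by
      refine (sum_exp_perm_le n (pairVariance ε k) (abs_pairVariance_mul_swap_sub_le k hε) hm
        s).trans (le_of_eq ?_)
      ring_nf)
  refine le_trans (le_of_eq ?_) h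
  refine sum_congr rfl fun π _ => ?_
  congr 2
  ring

theorem sum_pairVariance {n : ℕ} (hn : 2 ≤ n) (k : ℕ) (ε : Fin n → ℝ) :
    ∑ π, pairVariance ε k π = Fintype.card (Perm (Fin n)) *
      ((min k (n - k) : ℕ) * (n ^ 2 * gammaSq ε - total ε ^ 2) / (2 * n * (n - 1))) := by
  have hn' : (2 : ℝ) ≤ n := by exact_mod_cast hn
  have hnn : (n * (n - 1) : ℝ) ≠ 0 := mul_ne_zero (by linarith) (by linarith)
  have hF : ∑ a, ∑ b, ((ε a - ε b) / 2) ^ 2 = (n ^ 2 * gammaSq ε - total ε ^ 2) / 2 := by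
    have h1 : ∀ a b, ((ε a - ε b) / 2) ^ 2 = ε a ^ 2 / 4 + ε b ^ 2 / 4 - ε a * ε b / 2 := by
      intro a b; ring
    simp only [h1, sum_add_distrib, sum_sub_distrib, ← sum_div, ← mul_sum, ← sum_mul, sum_const,
      card_univ, Fintype.card_fin, nsmul_eq_mul]
    unfold gammaSq total
    field_simp
    ring
  have hpair : ∀ i ∈ leftHalf n k, ∑ π : Perm (Fin n), halfDiff ε π i ^ 2
      = Fintype.card (Perm (Fin n)) * ((n ^ 2 * gammaSq ε - total ε ^ 2) / (2 * n * (n - 1))) := by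
    intro i hi
    have hne : i ≠ i.rev := by
      intro h
      have h' := congrArg Fin.val h
      rw [mem_leftHalf] at hi
      rw [Fin.val_rev] at h'
      omega
    have h := sum_perm_pair (fun a b => ((ε a - ε b) / 2) ^ 2) (by simp) hne
    rw [hF] at h
    apply mul_left_cancel₀ hnn
    unfold halfDiff
    rw [h]
    have h1 : (n : ℝ) - 1 ≠ 0 := by linarith
    field_simp
  unfold pairVariance
  rw [sum_comm, sum_congr rfl hpair, sum_const, card_leftHalf, nsmul_eq_mul]
  ring

theorem gammaSq_nonneg {n : ℕ} (ε : Fin n → ℝ) : 0 ≤ gammaSq ε := by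
  unfold gammaSq
  exact div_nonneg (sum_nonneg fun _ _ => sq_nonneg _) (Nat.cast_nonneg n)

theorem gammaSq_le {n : ℕ} {ε : Fin n → ℝ} {B : ℝ} (hε : ∀ i, |ε i| ≤ B) :
    gammaSq ε ≤ B ^ 2 := by
  unfold gammaSq
  refine div_le_of_le_mul₀ (Nat.cast_nonneg n) (sq_nonneg B) ?_
  calc ∑ i, ε i ^ 2 ≤ ∑ _i : Fin n, B ^ 2 :=
        sum_le_sum fun i _ => sq_le_sq' (abs_le.1 (hε i)).1 (abs_le.1 (hε i)).2
    _ = _ := by simp [mul_comm]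

theorem sq_total_le {n : ℕ} {ε : Fin n → ℝ} {B : ℝ} (hε : ∀ i, |ε i| ≤ B) :
    total ε ^ 2 ≤ (n * B) ^ 2 := by
  have h : |total ε| ≤ n * B := by
    unfold total
    calc |∑ i, ε i| ≤ ∑ i, |ε i| := abs_sum_le_sum_abs _ _
      _ ≤ ∑ _i : Fin n, B := sum_le_sum fun i _ => hε i
      _ = _ := by simp
  exact sq_le_sq' (abs_le.1 h).1 (abs_le.1 h).2

/-- The mean of `pairVariance` differs from `γ² k (n - k) / n` by at most a bounded quantity plus
`Sₙ² / n`. -/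
theorem abs_mean_pairVariance_sub_le {n k : ℕ} (hn : 2 ≤ n)
    (hk : |2 * (k : ℤ) - (n : ℤ)| ≤ 1) (ε : Fin n → ℝ) :
    |(min k (n - k) : ℕ) * (n ^ 2 * gammaSq ε - total ε ^ 2) / (2 * n * (n - 1))
        - gammaSq ε * (k * (n - k) / n)| ≤ gammaSq ε / 2 + total ε ^ 2 / (2 * n) := by
  obtain ⟨h1, h2⟩ := abs_two_mul_sub_le hk
  have hn' : (2 : ℝ) ≤ n := by exact_mod_cast hn
  have hn1 : (0 : ℝ) < n - 1 := by linarith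
  have hn0 : (0 : ℝ) < n := by linarith
  have hg := gammaSq_nonneg ε
  set G := gammaSq ε
  set S := total ε ^ 2 with hS
  have hS0 : 0 ≤ S := sq_nonneg _
  have hodd : ∀ p : ℝ, n = 2 * p + 1 → p * (n ^ 2 * G - S) / (2 * n * (n - 1))
      - G * (p * (p + 1) / n) = (G - S) / (4 * n) := by
    intro p hp
    have hp0 : p ≠ 0 := by intro h; rw [h] at hp; linarith
    rw [hp] at hn0 ⊢
    field_simp
    ring
  have hoddle : |(G - S) / (4 * n)| ≤ G / 2 + S / (2 * n) := by
    rw [abs_div, abs_of_pos (show (0 : ℝ) < 4 * n by linarith), div_le_iff₀ (by linarith)]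
    have e : (G / 2 + S / (2 * n)) * (4 * n) = 2 * n * G + 2 * S := by field_simp; ring
    rw [e, abs_le]
    constructor <;> nlinarith
  rcases (show n = 2 * k ∨ n = 2 * k + 1 ∨ n + 1 = 2 * k by omega) with h | h | h
  · have hmin : min k (n - k) = k := by omega
    have hc : (n : ℝ) = 2 * k := by exact_mod_cast h
    have e : (k : ℝ) * (n ^ 2 * G - S) / (2 * n * (n - 1)) - G * (k * (n - k) / n)
        = (n * G - S) / (4 * (n - 1)) := by
      have hk2 : (k : ℝ) = n / 2 := by linarith
      have hne := hn1.ne'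
      rw [hk2]
      field_simp
      ring
    rw [hmin, e, abs_div, abs_of_pos (show (0 : ℝ) < 4 * (n - 1) by linarith),
      div_le_iff₀ (by linarith)]
    have e2 : (G / 2 + S / (2 * n)) * (4 * (n - 1)) = (2 * (n - 1)) * G + (2 * (n - 1) / n) * S := by
      field_simp; ring
    have e3 : 1 ≤ 2 * ((n : ℝ) - 1) / n := by rw [le_div_iff₀ hn0]; linarith
    rw [e2, abs_le]
    constructor <;> nlinarith
  · have hmin : min k (n - k) = k := by omega
    have hc : (n : ℝ) = 2 * k + 1 := by exact_mod_cast h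
    rw [hmin, show (n : ℝ) - k = k + 1 by linarith, hodd k hc]
    exact hoddle
  · have hmin : ((min k (n - k) : ℕ) : ℝ) = (k : ℝ) - 1 := by
      rw [show min k (n - k) = k - 1 by omega, Nat.cast_sub (by omega)]
      simp
    have hc : (n : ℝ) + 1 = 2 * k := by exact_mod_cast h
    have ho := hodd (k - 1) (by linarith)
    rw [hmin, show (k : ℝ) * (n - k) = (k - 1) * (k - 1 + 1) by
      rw [show (n : ℝ) - k = k - 1 by linarith]; ring, ho]
    exact hoddle

theorem sq_le_of_abs_le_half_add {n : ℕ} (hn : 1 ≤ n) {x G S B : ℝ} (hG : 0 ≤ G) (hGB : G ≤ B ^ 2)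
    (hS : 0 ≤ S) (hSB : S ≤ (n * B) ^ 2) (hx : |x| ≤ G / 2 + S / (2 * n)) :
    x ^ 2 ≤ n * (B ^ 4 / 2 + B ^ 2 * S / (2 * n)) := by
  have hn1 : (1 : ℝ) ≤ n := by exact_mod_cast hn
  calc x ^ 2 ≤ (G / 2 + S / (2 * n)) ^ 2 := sq_le_sq' (abs_le.1 hx).1 (abs_le.1 hx).2
    _ ≤ G ^ 2 / 2 + S * S / (2 * n ^ 2) := by
        have e : S * S / (2 * (n : ℝ) ^ 2) = 2 * (S / (2 * n)) ^ 2 := by field_simp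
        rw [e]
        nlinarith [sq_nonneg (G / 2 - S / (2 * n))]
    _ ≤ (B ^ 2) ^ 2 / 2 + (n * B) ^ 2 * S / (2 * n ^ 2) := by gcongr
    _ = B ^ 4 / 2 + B ^ 2 * S / 2 := by field_simp
    _ ≤ n * (B ^ 4 / 2) + B ^ 2 * S / 2 := by
        have : 0 ≤ B ^ 4 / 2 := by positivity
        nlinarith
    _ = _ := by field_simp

/-- Comparison of the conditional standard deviation `√V` with `η r`, where `r² = k (n - k) / n`;
the factor `η ≥ ν` keeps the denominator in `|√V - η r| ≤ |V - η² r²| / (η r)` away from `0`. -/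
theorem exists_sq_sqrt_pairVariance_sub_le {n k : ℕ} (hn : 1 ≤ n)
    (hk : |2 * (k : ℤ) - (n : ℤ)| ≤ 1) {ε : Fin n → ℝ} {B ν η : ℝ} (hε : ∀ i, |ε i| ≤ B)
    (hν : 0 < ν) (hη : ν ≤ η) :
    ∃ m : ℝ, ∑ π, pairVariance ε k π = Fintype.card (Perm (Fin n)) * m ∧
      ∀ π, (Real.sqrt (pairVariance ε k π) - η * Real.sqrt (k * (n - k) / n)) ^ 2
        ≤ 24 / ν ^ 2 * ((pairVariance ε k π - m) ^ 2 / n + B ^ 4 / 2 + B ^ 2 * total ε ^ 2 / (2 * n)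
          + n * (gammaSq ε - η ^ 2) ^ 2 / 16) := by
  obtain ⟨h1, h2⟩ := abs_two_mul_sub_le hk
  have hn0 : (0 : ℝ) < n := by exact_mod_cast hn
  rcases Nat.lt_or_ge n 2 with hlt | hge
  · -- For `n = 1` there are no pairs and both terms vanish.
    refine ⟨(∑ π, pairVariance ε k π) / Fintype.card (Perm (Fin n)), by field_simp, fun π => ?_⟩
    have hn1 : n = 1 := by omega
    have hempty : leftHalf n k = ∅ := by
      rw [← card_eq_zero, card_leftHalf]; omega
    have hV : pairVariance ε k π = 0 := by
      unfold pairVariance; rw [hempty]; simp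
    have hr : (k : ℝ) * (n - k) / n = 0 := by
      rcases (show k = 0 ∨ k = 1 by omega) with h | h <;> simp [h, hn1]
    have hL : (Real.sqrt (pairVariance ε k π) - η * Real.sqrt (k * (n - k) / n)) ^ 2 = 0 := by
      rw [hr, hV]; simp
    rw [hL]
    positivity
  · refine ⟨_, sum_pairVariance hge k ε, fun π => ?_⟩
    set V := pairVariance ε k π with hVdef
    set m := ((min k (n - k) : ℕ) : ℝ) * (n ^ 2 * gammaSq ε - total ε ^ 2) / (2 * n * (n - 1))
      with hm
    have hmean := abs_mean_pairVariance_sub_le hge hk ε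
    rw [← hm] at hmean
    set r2 : ℝ := k * (n - k) / n with hr2
    have hV0 : 0 ≤ V := sum_nonneg fun _ _ => sq_nonneg _
    have h1' : (2 * k : ℝ) ≤ n + 1 := by exact_mod_cast h1
    have h2' : (n : ℝ) ≤ 2 * k + 1 := by exact_mod_cast h2
    have hge' : (2 : ℝ) ≤ n := by exact_mod_cast hge
    have hr_low : (n : ℝ) / 8 ≤ r2 := by
      rw [hr2, le_div_iff₀ hn0]
      nlinarith
    have hr_up : r2 ≤ n / 4 := by
      rw [hr2, div_le_iff₀ hn0]
      nlinarith [sq_nonneg ((n : ℝ) - 2 * k)]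
    have hr0 : 0 < r2 := by linarith
    have hη0 : 0 < η := hν.trans_le hη
    set s := Real.sqrt V
    set r := Real.sqrt r2
    have hs2 : s ^ 2 = V := Real.sq_sqrt hV0
    have hrr : r ^ 2 = r2 := Real.sq_sqrt hr0.le
    have hs0 : 0 ≤ s := Real.sqrt_nonneg _
    have hrp : 0 < r := Real.sqrt_pos.2 hr0
    have hstep : (s - η * r) ^ 2 * (ν ^ 2 * (n / 8)) ≤ (V - η ^ 2 * r2) ^ 2 := by
      have e : (V - η ^ 2 * r2) ^ 2 = (s - η * r) ^ 2 * (s + η * r) ^ 2 := by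
        rw [← hs2, ← hrr]; ring
      rw [e]
      apply mul_le_mul_of_nonneg_left _ (sq_nonneg _)
      calc ν ^ 2 * ((n : ℝ) / 8) ≤ η ^ 2 * r2 := by gcongr
        _ = (η * r) ^ 2 := by rw [mul_pow, hrr]
        _ ≤ _ := by gcongr; linarith
    have hthree : (V - η ^ 2 * r2) ^ 2 ≤ 3 * ((V - m) ^ 2 + (m - gammaSq ε * r2) ^ 2
        + ((gammaSq ε - η ^ 2) * r2) ^ 2) := by
      have e : V - η ^ 2 * r2 = (V - m) + (m - gammaSq ε * r2) + (gammaSq ε - η ^ 2) * r2 := by ring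
      rw [e]
      nlinarith [sq_nonneg ((V - m) - (m - gammaSq ε * r2)),
        sq_nonneg ((V - m) - (gammaSq ε - η ^ 2) * r2),
        sq_nonneg ((m - gammaSq ε * r2) - (gammaSq ε - η ^ 2) * r2)]
    have hB2 := gammaSq_le hε
    have hG0 := gammaSq_nonneg ε
    have hS := sq_total_le hε
    have hmid : (m - gammaSq ε * r2) ^ 2 ≤ n * (B ^ 4 / 2 + B ^ 2 * total ε ^ 2 / (2 * n)) :=
      sq_le_of_abs_le_half_add hn hG0 hB2 (sq_nonneg _) hS hmean
    have hlast : ((gammaSq ε - η ^ 2) * r2) ^ 2 ≤ (gammaSq ε - η ^ 2) ^ 2 * (n ^ 2 / 16) := by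
      rw [mul_pow]
      apply mul_le_mul_of_nonneg_left _ (sq_nonneg _)
      calc r2 ^ 2 ≤ ((n : ℝ) / 4) ^ 2 := by gcongr
        _ = _ := by ring
    have hpos : 0 < ν ^ 2 * ((n : ℝ) / 8) := by positivity
    rw [← mul_le_mul_iff_left₀ hpos]
    refine hstep.trans (hthree.trans ?_)
    have e : 24 / ν ^ 2 * ((V - m) ^ 2 / n + B ^ 4 / 2 + B ^ 2 * total ε ^ 2 / (2 * n)
        + n * (gammaSq ε - η ^ 2) ^ 2 / 16) * (ν ^ 2 * (n / 8))
      = 3 * ((V - m) ^ 2 + n * (B ^ 4 / 2 + B ^ 2 * total ε ^ 2 / (2 * n))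
        + (gammaSq ε - η ^ 2) ^ 2 * (n ^ 2 / 16)) := by
      field_simp
      ring
    rw [e]
    gcongr

end PairVariance

/-! ### The common probability space -/

section CouplingSpace

open Finset

/-- Independent pairs of independent standard Gaussian variables, indexed by `ι`. -/
noncomputable def gaussianPairs (ι : Type*) [Fintype ι] : Measure (ι → ℝ × ℝ) :=
  Measure.pi fun _ => (gaussianReal 0 1).prod (gaussianReal 0 1)

instance isProbabilityMeasure_gaussianPairs (ι : Type*) [Fintype ι] :
    IsProbabilityMeasure (gaussianPairs ι) := by
  unfold gaussianPairs; infer_instance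

/-- A uniform random element of `X` together with independent Gaussian pairs. -/
noncomputable def couplingSpace (X ι : Type*) [Fintype X] [Nonempty X] [MeasurableSpace X]
    [Fintype ι] : Measure (X × (ι → ℝ × ℝ)) :=
  (PMF.uniformOfFintype X).toMeasure.prod (gaussianPairs ι)

instance isProbabilityMeasure_couplingSpace (X ι : Type*) [Fintype X] [Nonempty X]
    [MeasurableSpace X] [Fintype ι] : IsProbabilityMeasure (couplingSpace X ι) := by
  unfold couplingSpace; infer_instance

theorem charFun_map_couplingSpace {X ι : Type*} [Fintype X] [Nonempty X] [MeasurableSpace X]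
    [MeasurableSingletonClass X] [Fintype ι] {f : X × (ι → ℝ × ℝ) → ℝ} (hf : Measurable f)
    (t : ℝ) :
    charFun ((couplingSpace X ι).map f) t = (Fintype.card X : ℝ)⁻¹ •
      ∑ x, ∫ w, Complex.exp (t * f (x, w) * Complex.I) ∂(gaussianPairs ι) := by
  rw [charFun_apply_real, integral_map hf.aemeasurable (by fun_prop)]
  unfold couplingSpace
  rw [integral_prod, integral_uniformOfFintype]
  refine Integrable.of_bound (by fun_prop) 1 (Filter.Eventually.of_forall fun y => ?_)
  rw [← Complex.ofReal_mul, Complex.norm_exp_ofReal_mul_I]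

theorem integral_exp_sum_gaussianPairs {ι : Type*} [Fintype ι] (F : ι → ℝ × ℝ → ℝ) (t : ℝ) :
    ∫ w, Complex.exp (t * (∑ d, F d (w d) : ℝ) * Complex.I) ∂(gaussianPairs ι)
      = ∏ d, ∫ z, Complex.exp (t * F d z * Complex.I)
        ∂((gaussianReal 0 1).prod (gaussianReal 0 1)) := by
  unfold gaussianPairs
  rw [← integral_fintype_prod_eq_prod]
  refine integral_congr_ae (Filter.Eventually.of_forall fun w => ?_)
  simp only
  rw [← Complex.exp_sum]
  push_cast
  rw [mul_sum, sum_mul]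

/-- A linear combination with unit coefficient vector of the first Gaussian coordinates is a
standard Gaussian variable. -/
theorem integral_exp_linear_gaussianPairs {ι : Type*} [Fintype ι] {u : ι → ℝ}
    (hu : ∑ d, u d ^ 2 = 1) (t : ℝ) :
    ∫ w, Complex.exp (t * (∑ d, u d * (w d).1 : ℝ) * Complex.I) ∂(gaussianPairs ι)
      = Complex.exp (-(t ^ 2 / 2)) := by
  rw [integral_exp_sum_gaussianPairs (fun d z => u d * z.1)]
  have h : ∀ d, ∫ z : ℝ × ℝ, Complex.exp (t * (u d * z.1 : ℝ) * Complex.I)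
      ∂((gaussianReal 0 1).prod (gaussianReal 0 1)) = Complex.exp (-(t ^ 2 / 2) * u d ^ 2) := by
    intro d
    have h1 := integral_fun_fst (μ := gaussianReal 0 1) (ν := gaussianReal 0 1)
      (fun g : ℝ => Complex.exp (t * (u d * g : ℝ) * Complex.I))
    rw [h1]
    have h2 := charFun_gaussianReal (μ := 0) (v := 1) (t * u d)
    rw [charFun_apply_real] at h2
    simp only [probReal_univ, one_smul]
    refine Eq.trans ?_ (h2.trans ?_)
    · refine integral_congr_ae (Filter.Eventually.of_forall fun g => ?_)
      simp only
      push_cast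
      ring_nf
    · congr 1
      push_cast
      ring
  rw [prod_congr rfl fun d _ => h d, ← Complex.exp_sum, ← mul_sum]
  have : (∑ d, (u d : ℂ) ^ 2) = 1 := by exact_mod_cast congrArg (fun x : ℝ => (x : ℂ)) hu
  rw [this, mul_one]

/-- Polar decomposition of a coefficient vector; the direction is arbitrary when `v = 0`, so that the
Gaussian variable built from it is standard in every case. -/
theorem exists_unit_vector {ι : Type*} [Fintype ι] [Nonempty ι] (v : ι → ℝ) :
    ∃ u : ι → ℝ, ∑ d, u d ^ 2 = 1 ∧ ∀ d, v d = Real.sqrt (∑ d, v d ^ 2) * u d := by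
  classical
  have h0 : 0 ≤ ∑ d, v d ^ 2 := sum_nonneg fun _ _ => sq_nonneg _
  rcases h0.eq_or_lt with h | h
  · obtain ⟨d₀⟩ := ‹Nonempty ι›
    refine ⟨Pi.single d₀ 1, ?_, fun d => ?_⟩
    · rw [Fintype.sum_eq_single d₀ (fun d hd => by simp [Pi.single_eq_of_ne hd])]
      simp
    · have := (sum_eq_zero_iff_of_nonneg fun d _ => sq_nonneg (v d)).1 h.symm d (mem_univ d)
      rw [← h]
      simpa using this
  · have hs : Real.sqrt (∑ d, v d ^ 2) ≠ 0 := (Real.sqrt_pos.2 h).ne'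
    refine ⟨fun d => v d / Real.sqrt (∑ d, v d ^ 2), ?_, fun d => by field_simp⟩
    simp only [div_pow, Real.sq_sqrt h0]
    rw [← sum_div, div_self h.ne']

theorem integrable_exp_sq_coord {ι : Type*} [Fintype ι] (d : ι) :
    Integrable (fun w : ι → ℝ × ℝ => Real.exp ((w d).1 ^ 2 / 4)) (gaussianPairs ι) := by
  have h1 : MeasurePreserving (fun w : ι → ℝ × ℝ => (w d).1) (gaussianPairs ι)
      (gaussianReal 0 1) :=
    measurePreserving_fst.comp (measurePreserving_eval
      (fun _ : ι => (gaussianReal 0 1).prod (gaussianReal 0 1)) d)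
  exact h1.integrable_comp_of_integrable integrable_exp_sq_div_four

theorem integral_exp_sq_coord {ι : Type*} [Fintype ι] (d : ι) :
    ∫ w : ι → ℝ × ℝ, Real.exp ((w d).1 ^ 2 / 4) ∂(gaussianPairs ι) = Real.sqrt 2 := by
  have h1 : MeasurePreserving (fun w : ι → ℝ × ℝ => (w d).1) (gaussianPairs ι)
      (gaussianReal 0 1) :=
    measurePreserving_fst.comp (measurePreserving_eval
      (fun _ : ι => (gaussianReal 0 1).prod (gaussianReal 0 1)) d)
  rw [← integral_exp_sq_div_four, ← h1.map_eq, integral_map h1.measurable.aemeasurable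
    (by fun_prop)]

theorem exp_sum_sq_le {ι : Type*} [Fintype ι] [Nonempty ι] (w : ι → ℝ × ℝ) :
    Real.exp ((∑ d, (w d).1 ^ 2) / (4 * Fintype.card ι))
      ≤ (Fintype.card ι : ℝ)⁻¹ * ∑ d, Real.exp ((w d).1 ^ 2 / 4) := by
  have hm : (0 : ℝ) < Fintype.card ι := by exact_mod_cast Fintype.card_pos
  have h := convexOn_exp.map_sum_le (t := univ) (w := fun _ : ι => (Fintype.card ι : ℝ)⁻¹)
    (p := fun d => (w d).1 ^ 2 / 4) (fun _ _ => by positivity)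
    (by simp) (fun _ _ => Set.mem_univ _)
  simp only [smul_eq_mul] at h
  rw [← mul_sum, ← mul_sum] at h
  refine le_trans (le_of_eq ?_) h
  rw [← sum_div]
  congr 1
  field_simp

theorem integrable_exp_sum_sq (ι : Type*) [Fintype ι] [Nonempty ι] :
    Integrable (fun w : ι → ℝ × ℝ => Real.exp ((∑ d, (w d).1 ^ 2) / (4 * Fintype.card ι)))
      (gaussianPairs ι) := by
  refine Integrable.mono' ((integrable_finsetSum univ fun d _ =>
    integrable_exp_sq_coord d).const_mul (Fintype.card ι : ℝ)⁻¹) ?_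
    (Filter.Eventually.of_forall fun w => ?_)
  · exact (by fun_prop : Measurable _).aestronglyMeasurable
  · rw [Real.norm_of_nonneg (Real.exp_pos _).le]
    exact exp_sum_sq_le w

theorem integral_exp_sum_sq_le (ι : Type*) [Fintype ι] [Nonempty ι] :
    ∫ w : ι → ℝ × ℝ, Real.exp ((∑ d, (w d).1 ^ 2) / (4 * Fintype.card ι)) ∂(gaussianPairs ι)
      ≤ Real.sqrt 2 := by
  have hm : (Fintype.card ι : ℝ) ≠ 0 := by exact_mod_cast Fintype.card_ne_zero
  refine (integral_mono (integrable_exp_sum_sq ι) ((integrable_finsetSum univ fun d _ =>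
    integrable_exp_sq_coord d).const_mul (Fintype.card ι : ℝ)⁻¹) exp_sum_sq_le).trans
    (le_of_eq ?_)
  rw [integral_const_mul, integral_finsetSum _ fun d _ => integrable_exp_sq_coord d]
  simp only [integral_exp_sq_coord, sum_const, card_univ, nsmul_eq_mul]
  field_simp

/-- Exponential moments on the coupling space of a variable `D` bounded by
`C (1 + G) + a √G`, where `G` is the sum of the squared Gaussian coordinates: the cross term is
split by `θ a √G ≤ 2 m θ² a² + G / (8 m)`. -/
theorem integral_exp_couplingSpace_le {X ι : Type*} [Fintype X] [Nonempty X] [MeasurableSpace X]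
    [MeasurableSingletonClass X] [Fintype ι] [Nonempty ι] {D : X × (ι → ℝ × ℝ) → ℝ}
    (hD : Measurable D) {a : X → ℝ} {C₀ C₁ θ : ℝ} (hθ : 0 ≤ θ)
    (hC₁ : θ * C₁ ≤ 1 / (8 * Fintype.card ι))
    (hbound : ∀ x w, |D (x, w)| ≤ C₀ + C₁ * ∑ d, (w d).1 ^ 2
      + |a x| * Real.sqrt (∑ d, (w d).1 ^ 2)) :
    Integrable (fun p => Real.exp (θ * |D p|)) (couplingSpace X ι) ∧
      ∫ p, Real.exp (θ * |D p|) ∂(couplingSpace X ι) ≤ Real.exp (θ * C₀) * Real.sqrt 2 *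
        ((Fintype.card X : ℝ)⁻¹ * ∑ x, Real.exp (2 * Fintype.card ι * θ ^ 2 * a x ^ 2)) := by
  have hm : (0 : ℝ) < Fintype.card ι := by exact_mod_cast Fintype.card_pos
  set m : ℝ := (Fintype.card ι : ℝ) with hmdef
  set f : X → ℝ := fun x => Real.exp (θ * C₀) * Real.exp (2 * m * θ ^ 2 * a x ^ 2) with hf
  set g : (ι → ℝ × ℝ) → ℝ := fun w => Real.exp ((∑ d, (w d).1 ^ 2) / (4 * m)) with hg
  have hle : ∀ p : X × (ι → ℝ × ℝ), Real.exp (θ * |D p|) ≤ f p.1 * g p.2 := by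
    rintro ⟨x, w⟩
    simp only [hf, hg, ← Real.exp_add]
    apply Real.exp_le_exp.2
    set G := ∑ d, (w d).1 ^ 2 with hG
    have hG0 : 0 ≤ G := sum_nonneg fun _ _ => sq_nonneg _
    have hsq : Real.sqrt G ^ 2 = G := Real.sq_sqrt hG0
    have hcross : θ * |a x| * Real.sqrt G ≤ 2 * m * θ ^ 2 * a x ^ 2 + G / (8 * m) := by
      have e : 2 * m * θ ^ 2 * a x ^ 2 + G / (8 * m) - θ * |a x| * Real.sqrt G
          = (4 * m * (θ * |a x|) - Real.sqrt G) ^ 2 / (8 * m) := by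
        rw [sub_sq, hsq, mul_pow, mul_pow, mul_pow, sq_abs]
        field_simp
        ring
      have : 0 ≤ (4 * m * (θ * |a x|) - Real.sqrt G) ^ 2 / (8 * m) := by positivity
      linarith
    have h1 := mul_le_mul_of_nonneg_left (hbound x w) hθ
    have h2 := mul_le_mul_of_nonneg_right hC₁ hG0
    have h3 : G / (4 * m) = 1 / (8 * m) * G + G / (8 * m) := by field_simp; ring
    rw [h3]
    linarith
  have hfi : Integrable f (PMF.uniformOfFintype X).toMeasure := Integrable.of_finite
  have hgi : Integrable g (gaussianPairs ι) := integrable_exp_sum_sq ι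
  have hint : Integrable (fun p : X × (ι → ℝ × ℝ) => f p.1 * g p.2) (couplingSpace X ι) :=
    hfi.mul_prod hgi
  have hint2 : Integrable (fun p => Real.exp (θ * |D p|)) (couplingSpace X ι) := by
    refine hint.mono' ?_ (Filter.Eventually.of_forall fun p => ?_)
    · have : Measurable fun p => Real.exp (θ * |D p|) :=
        Real.measurable_exp.comp ((measurable_norm.comp hD).const_mul θ)
      exact this.aestronglyMeasurable
    · rw [Real.norm_of_nonneg (Real.exp_pos _).le]
      exact hle p
  refine ⟨hint2, (integral_mono hint2 hint hle).trans ?_⟩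
  unfold couplingSpace
  rw [integral_prod_mul, integral_uniformOfFintype, smul_eq_mul]
  have hS : 0 ≤ (Fintype.card X : ℝ)⁻¹ * ∑ x, f x := by
    have : ∀ x, 0 ≤ f x := fun x => by simp only [hf]; positivity
    exact mul_nonneg (by positivity) (sum_nonneg fun x _ => this x)
  refine (mul_le_mul_of_nonneg_left (integral_exp_sum_sq_le ι) hS).trans (le_of_eq ?_)
  simp only [hf, ← mul_sum]
  ring

end CouplingSpace

/-! ### Grouping the pairs by the values of their entries -/

section Kinds

open Finset Equiv PermWalk

/-- The pair of values of `ε` at the positions `i` and `i.rev`. -/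
def pairKind {A : Finset ℝ} {n : ℕ} {ε : Fin n → ℝ} (hε : ∀ i, ε i ∈ A) (π : Perm (Fin n))
    (i : Fin n) : A × A :=
  (⟨ε (π i), hε _⟩, ⟨ε (π i.rev), hε _⟩)

/-- Half the difference of the two values of a kind. -/
noncomputable def kindCoeff {A : Finset ℝ} (d : A × A) : ℝ := ((d.1 : ℝ) - d.2) / 2

/-- The number of pairs of a given kind. -/
noncomputable def pairCount {A : Finset ℝ} {n : ℕ} {ε : Fin n → ℝ} (hε : ∀ i, ε i ∈ A) (k : ℕ)
    (π : Perm (Fin n)) (d : A × A) : ℕ :=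
  ((leftHalf n k).filter fun i => pairKind hε π i = d).card

variable {A : Finset ℝ} {n : ℕ} {ε : Fin n → ℝ} (hε : ∀ i, ε i ∈ A) (k : ℕ) (π : Perm (Fin n))

theorem kindCoeff_pairKind (i : Fin n) : kindCoeff (pairKind hε π i) = halfDiff ε π i := rfl

theorem pairVariance_eq_sum_kinds :
    pairVariance ε k π
      = ∑ d, (kindCoeff d * Real.sqrt (pairCount hε k π d)) ^ 2 := by
  unfold pairVariance
  rw [← sum_fiberwise (leftHalf n k) (pairKind hε π)]
  refine sum_congr rfl fun d _ => ?_
  rw [sum_congr rfl (g := fun _ => kindCoeff d ^ 2), sum_const, nsmul_eq_mul, mul_pow,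
    Real.sq_sqrt (Nat.cast_nonneg _), mul_comm]
  · rfl
  · intro i hi
    rw [← (mem_filter.1 hi).2, kindCoeff_pairKind]

theorem prod_cos_eq_prod_kinds (t : ℝ) :
    ∏ i ∈ leftHalf n k, (Real.cos (t * halfDiff ε π i) : ℂ)
      = ∏ d, (Real.cos (t * kindCoeff d) : ℂ) ^ pairCount hε k π d := by
  rw [← prod_fiberwise (leftHalf n k) (pairKind hε π)]
  refine prod_congr rfl fun d _ => ?_
  rw [prod_congr rfl (g := fun _ => (Real.cos (t * kindCoeff d) : ℂ)), prod_const]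
  · rfl
  · intro i hi
    rw [← (mem_filter.1 hi).2, kindCoeff_pairKind]

end Kinds

/-! ### The coupling -/

section Coupling

open Finset Equiv PermWalk

/-- Given the unordered pairs, the bridge is `pairCenter` plus a sum over kinds of independent
sign sums, and each sign sum may be replaced by any variable of the same law. -/
theorem map_couplingSpace_eq_bridgeLaw {A : Finset ℝ} {n : ℕ} {ε : Fin n → ℝ}
    (hε : ∀ i, ε i ∈ A) (k : ℕ) [MeasurableSpace (Perm (Fin n))]
    [MeasurableSingletonClass (Perm (Fin n))] {Q : ℕ → ℝ × ℝ → ℝ}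
    (hQint : ∀ (M : ℕ) (t : ℝ), ∫ z, Complex.exp (t * Q M z * Complex.I)
        ∂((gaussianReal 0 1).prod (gaussianReal 0 1)) = (Real.cos t : ℂ) ^ M)
    {W : Perm (Fin n) × (A × A → ℝ × ℝ) → ℝ} (hWm : Measurable W)
    (hW : ∀ π w, W (π, w)
      = pairCenter ε k π + ∑ d, kindCoeff d * Q (pairCount hε k π d) (w d)) :
    (couplingSpace (Perm (Fin n)) (A × A)).map W = bridgeLaw ε k := by
  have h1 : IsProbabilityMeasure ((couplingSpace (Perm (Fin n)) (A × A)).map W) :=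
    Measure.isProbabilityMeasure_map hWm.aemeasurable
  have h2 : IsProbabilityMeasure (bridgeLaw ε k) := by
    unfold bridgeLaw; infer_instance
  refine Measure.ext_of_charFun (funext fun t => ?_)
  rw [charFun_map_couplingSpace hWm, charFun_bridgeLaw]
  congr 1
  refine sum_congr rfl fun π _ => ?_
  rw [prod_cos_eq_prod_kinds hε]
  have hsplit : ∀ w : A × A → ℝ × ℝ, Complex.exp (t * W (π, w) * Complex.I)
      = Complex.exp (t * pairCenter ε k π * Complex.I) * Complex.exp
        (t * (∑ d, kindCoeff d * Q (pairCount hε k π d) (w d) : ℝ) * Complex.I) := by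
    intro w
    rw [← Complex.exp_add, hW]
    congr 1
    push_cast
    ring
  simp only [hsplit]
  rw [integral_const_mul,
    integral_exp_sum_gaussianPairs (fun d z => kindCoeff d * Q (pairCount hε k π d) z)]
  congr 1
  refine prod_congr rfl fun d _ => ?_
  rw [← hQint]
  refine integral_congr_ae (Filter.Eventually.of_forall fun z => ?_)
  simp only
  congr 2
  push_cast
  ring

theorem map_couplingSpace_eq_gaussianReal {X ι : Type*} [Fintype X] [Nonempty X]
    [MeasurableSpace X] [MeasurableSingletonClass X] [Fintype ι] {u : X → ι → ℝ}
    (hu : ∀ x, ∑ d, u x d ^ 2 = 1) {v : ℝ} (hv : 0 ≤ v) {Z : X × (ι → ℝ × ℝ) → ℝ}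
    (hZm : Measurable Z) (hZ : ∀ x w, Z (x, w) = Real.sqrt v * ∑ d, u x d * (w d).1) :
    (couplingSpace X ι).map Z = gaussianReal 0 v.toNNReal := by
  have h1 : IsProbabilityMeasure ((couplingSpace X ι).map Z) :=
    Measure.isProbabilityMeasure_map hZm.aemeasurable
  refine Measure.ext_of_charFun (funext fun t => ?_)
  rw [charFun_map_couplingSpace hZm, charFun_gaussianReal]
  have hx : ∀ x, ∫ w, Complex.exp (t * Z (x, w) * Complex.I) ∂(gaussianPairs ι)
      = Complex.exp (-(((t * Real.sqrt v : ℝ) : ℂ) ^ 2 / 2)) := by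
    intro x
    rw [← integral_exp_linear_gaussianPairs (hu x)]
    refine integral_congr_ae (Filter.Eventually.of_forall fun w => ?_)
    simp only [hZ]
    push_cast
    ring_nf
  rw [sum_congr rfl fun x _ => hx x, sum_const, card_univ, ← Nat.cast_smul_eq_nsmul ℝ,
    inv_smul_smul₀ (by exact_mod_cast Fintype.card_ne_zero)]
  congr 1
  have hsq : ((Real.sqrt v : ℝ) : ℂ) ^ 2 = v := by
    exact_mod_cast congrArg (fun x : ℝ => (x : ℂ)) (Real.sq_sqrt hv)
  rw [Real.coe_toNNReal v hv]
  push_cast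
  rw [mul_pow, hsq]
  ring

/-- The pointwise estimate behind the coupling: each sign sum is within `O(1 + g²)` of its
Gaussian counterpart, and what remains is the difference of two multiples of one standard
Gaussian variable. -/
theorem abs_coupling_error_le {ι : Type*} [Fintype ι] {c s κ B : ℝ} {δ q g u b : ι → ℝ}
    (hB : 0 ≤ B) (hc : |c| ≤ 2 * B) (hδ : ∀ d, |δ d| ≤ B)
    (hq : ∀ d, |q d - b d * g d| ≤ 18 * (1 + g d ^ 2)) (hu : ∑ d, u d ^ 2 = 1)
    (hb : ∀ d, δ d * b d = s * u d) :
    |c + ∑ d, δ d * q d - κ * ∑ d, u d * g d|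
      ≤ (2 * B + 18 * Fintype.card ι * B) + 18 * B * ∑ d, g d ^ 2
        + |s - κ| * Real.sqrt (∑ d, g d ^ 2) := by
  have e : c + ∑ d, δ d * q d - κ * ∑ d, u d * g d
      = c + ∑ d, δ d * (q d - b d * g d) + (s - κ) * ∑ d, u d * g d := by
    have h1 : ∑ d, δ d * (q d - b d * g d) = ∑ d, δ d * q d - s * ∑ d, u d * g d := by
      rw [mul_sum, ← sum_sub_distrib]
      refine sum_congr rfl fun d _ => ?_
      rw [mul_sub, ← mul_assoc, hb, mul_assoc]
    rw [h1]; ring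
  rw [e]
  have h1 : |∑ d, δ d * (q d - b d * g d)| ≤ 18 * Fintype.card ι * B + 18 * B * ∑ d, g d ^ 2 := by
    calc _ ≤ ∑ d, |δ d * (q d - b d * g d)| := abs_sum_le_sum_abs _ _
      _ ≤ ∑ d, B * (18 * (1 + g d ^ 2)) := sum_le_sum fun d _ => by
          rw [abs_mul]
          exact mul_le_mul (hδ d) (hq d) (abs_nonneg _) hB
      _ = _ := by
          rw [← mul_sum, ← mul_sum, sum_add_distrib]
          simp
          ring
  have h2 : |∑ d, u d * g d| ≤ Real.sqrt (∑ d, g d ^ 2) := by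
    apply Real.abs_le_sqrt
    have := sum_mul_sq_le_sq_mul_sq univ u g
    rwa [hu, one_mul] at this
  refine (abs_add_le _ _).trans (add_le_add ((abs_add_le _ _).trans ?_) ?_)
  · linarith
  · rw [abs_mul]
    gcongr

theorem integral_exp_le_one_of_nonpos {Ω : Type*} [MeasurableSpace Ω] (P : Measure Ω)
    [IsProbabilityMeasure P] {D : Ω → ℝ} (hD : Measurable D) {θ : ℝ} (hθ : θ ≤ 0) :
    Integrable (fun ω => Real.exp (θ * |D ω|)) P ∧ ∫ ω, Real.exp (θ * |D ω|) ∂P ≤ 1 := by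
  have hm : Measurable fun ω => Real.exp (θ * |D ω|) :=
    Real.measurable_exp.comp ((measurable_norm.comp hD).const_mul θ)
  have hle : ∀ ω, Real.exp (θ * |D ω|) ≤ 1 := fun ω =>
    Real.exp_le_one_iff.2 (mul_nonpos_of_nonpos_of_nonneg hθ (abs_nonneg _))
  have hi : Integrable (fun ω => Real.exp (θ * |D ω|)) P := by
    refine Integrable.of_bound hm.aestronglyMeasurable 1 (Filter.Eventually.of_forall fun ω => ?_)
    rw [Real.norm_of_nonneg (Real.exp_pos _).le]
    exact hle ω
  refine ⟨hi, (integral_mono hi (integrable_const 1) hle).trans (by simp)⟩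

/-- Averaging the Gaussian exponential moments over the permutation. -/
theorem mul_sum_exp_le {X : Type*} [Fintype X] [Nonempty X] {V a : X → ℝ}
    {m B ν θ C₀ N T R μ : ℝ} (hm : 0 < m) (hB : 1 ≤ B) (hν : 0 < ν) (hN : 0 < N)
    (hθ : 0 ≤ θ) (hθ₁ : θ * C₀ ≤ 1) (hθ₂ : θ ≤ ν / (1000 * m * B ^ 2)) (hm1 : 1 ≤ m)
    (hV : ∑ x, Real.exp ((V x - μ) ^ 2 / (256 * N * B ^ 4)) ≤ Fintype.card X * Real.sqrt 2)
    (ha : ∀ x, a x ^ 2 ≤ 24 / ν ^ 2 * ((V x - μ) ^ 2 / N + B ^ 4 / 2 + B ^ 2 * T / (2 * N)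
      + N * R / 16)) :
    Real.exp (θ * C₀) * Real.sqrt 2 *
        ((Fintype.card X : ℝ)⁻¹ * ∑ x, Real.exp (2 * m * θ ^ 2 * a x ^ 2))
      ≤ Real.exp (3 + 24 * m * B ^ 2 / ν ^ 2 * θ ^ 2 * T / N + 3 * m / ν ^ 2 * θ ^ 2 * N * R) := by
  have hB0 : 0 < B := by linarith
  have hθsq : θ ^ 2 * (12288 * m * B ^ 4) ≤ ν ^ 2 := by
    have h1 : θ * (1000 * m * B ^ 2) ≤ ν := by
      rwa [le_div_iff₀ (by positivity)] at hθ₂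
    have h2 : (θ * (1000 * m * B ^ 2)) ^ 2 ≤ ν ^ 2 := by gcongr
    refine le_trans ?_ h2
    have e : (θ * (1000 * m * B ^ 2)) ^ 2 = θ ^ 2 * ((1000000 * m) * m * B ^ 4) := by ring
    rw [e]
    gcongr
    nlinarith
  set E : ℝ := 24 * m * B ^ 2 / ν ^ 2 * θ ^ 2 * T / N + 3 * m / ν ^ 2 * θ ^ 2 * N * R with hE
  have hterm : ∀ x, Real.exp (2 * m * θ ^ 2 * a x ^ 2)
      ≤ Real.exp (1 + E) * Real.exp ((V x - μ) ^ 2 / (256 * N * B ^ 4)) := by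
    intro x
    rw [← Real.exp_add]
    apply Real.exp_le_exp.2
    have h1 := mul_le_mul_of_nonneg_left (ha x) (show 0 ≤ 2 * m * θ ^ 2 by positivity)
    refine h1.trans ?_
    have e : 2 * m * θ ^ 2 * (24 / ν ^ 2 * ((V x - μ) ^ 2 / N + B ^ 4 / 2 + B ^ 2 * T / (2 * N)
        + N * R / 16)) = (θ ^ 2 * (12288 * m * B ^ 4)) / ν ^ 2 * ((V x - μ) ^ 2 / (256 * N * B ^ 4))
        + (θ ^ 2 * (12288 * m * B ^ 4)) / ν ^ 2 / 512 + E := by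
      rw [hE]
      field_simp
      ring
    rw [e]
    have h2 : (θ ^ 2 * (12288 * m * B ^ 4)) / ν ^ 2 ≤ 1 := by
      rw [div_le_one (by positivity)]; exact hθsq
    have h3 : 0 ≤ (V x - μ) ^ 2 / (256 * N * B ^ 4) := by positivity
    have h4 := mul_le_mul_of_nonneg_right h2 h3
    linarith
  have hcard : (0 : ℝ) < Fintype.card X := by exact_mod_cast Fintype.card_pos
  calc Real.exp (θ * C₀) * Real.sqrt 2 *
        ((Fintype.card X : ℝ)⁻¹ * ∑ x, Real.exp (2 * m * θ ^ 2 * a x ^ 2))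
      ≤ Real.exp 1 * Real.sqrt 2 *
        ((Fintype.card X : ℝ)⁻¹ * (Real.exp (1 + E) * (Fintype.card X * Real.sqrt 2))) := by
        gcongr
        calc ∑ x, Real.exp (2 * m * θ ^ 2 * a x ^ 2)
            ≤ ∑ x, Real.exp (1 + E) * Real.exp ((V x - μ) ^ 2 / (256 * N * B ^ 4)) :=
              sum_le_sum fun x _ => hterm x
          _ ≤ _ := by
              rw [← mul_sum]
              gcongr
    _ = Real.exp 1 * Real.exp (1 + E) * (Real.sqrt 2 * Real.sqrt 2) := by field_simp
    _ ≤ Real.exp 1 * Real.exp (1 + E) * Real.exp 1 := by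
        rw [Real.mul_self_sqrt (by norm_num)]
        gcongr
        linarith [Real.add_one_le_exp (1 : ℝ)]
    _ = _ := by
        rw [← Real.exp_add, ← Real.exp_add]
        congr 1
        rw [hE]
        ring

end Coupling

theorem theorem2p2 (A : Finset ℝ) (ν : ℝ) (hν : 0 < ν) :
    ∃ c₁ c₂ θ₂ : ℝ, 0 < c₁ ∧ 0 < c₂ ∧ 0 < θ₂ ∧
      ∀ (n : ℕ), 1 ≤ n → ∀ (ε : Fin n → ℝ), (∀ i, ε i ∈ A) →
      ∀ (k : ℕ), |2 * (k : ℤ) - (n : ℤ)| ≤ 1 → ∀ (η : ℝ), ν ≤ η →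
      ∃ (Ω : Type) (_ : MeasurableSpace Ω) (P : Measure Ω) (W Z : Ω → ℝ),
        IsProbabilityMeasure P ∧
        HasLaw W (PermWalk.bridgeLaw ε k) P ∧
        HasLaw Z (gaussianReal 0 (Real.toNNReal ((k : ℝ) * ((n : ℝ) - k) / n))) P ∧
        ∀ θ : ℝ, θ ≤ θ₂ →
          Integrable (fun ω => Real.exp (θ * |W ω - η * Z ω|)) P ∧
          ∫ ω, Real.exp (θ * |W ω - η * Z ω|) ∂P ≤
            Real.exp (3 + c₁ * θ ^ 2 * PermWalk.total ε ^ 2 / n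
              + c₂ * θ ^ 2 * n * (PermWalk.gammaSq ε - η ^ 2) ^ 2) := by
  -- With no available values there is no sequence of length `n ≥ 1`.
  rcases A.eq_empty_or_nonempty with rfl | hA
  · exact ⟨1, 1, 1, one_pos, one_pos, one_pos, fun n hn ε hε =>
      absurd (hε ⟨0, hn⟩) (Finset.notMem_empty _)⟩
  obtain ⟨Q, hQm, hQint, hQ⟩ := exists_sign_sum_coupling
  have hAne : Nonempty A := hA.to_subtype
  set m : ℝ := (Fintype.card (A × A) : ℝ) with hm
  have hm1 : 1 ≤ m := by
    rw [hm]; exact_mod_cast Nat.succ_le_of_lt Fintype.card_pos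
  have hm0 : 0 < m := by linarith
  set B : ℝ := 1 + ∑ a ∈ A, |a| with hBdef
  have hB1 : 1 ≤ B := le_add_of_nonneg_right (Finset.sum_nonneg fun _ _ => abs_nonneg _)
  have hB0 : 0 < B := by linarith
  have hAB : ∀ a ∈ A, |a| ≤ B := fun a ha => by
    have := Finset.single_le_sum (f := fun a => |a|) (fun _ _ => abs_nonneg _) ha
    linarith
  refine ⟨24 * m * B ^ 2 / ν ^ 2, 3 * m / ν ^ 2, min (1 / (144 * m * B)) (ν / (1000 * m * B ^ 2)),
    by positivity, by positivity, by positivity, ?_⟩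
  intro n hn ε hε k hk η hη
  have hεB : ∀ i, |ε i| ≤ B := fun i => hAB _ (hε i)
  have hn0 : (0 : ℝ) < n := by exact_mod_cast hn
  have hr0 : 0 ≤ (k : ℝ) * ((n : ℝ) - k) / n := by
    have hkn : (k : ℝ) ≤ n := by
      have h := abs_two_mul_sub_le hk
      have : k ≤ n := by omega
      exact_mod_cast this
    exact div_nonneg (mul_nonneg (Nat.cast_nonneg k) (by linarith)) hn0.le
  let _ : MeasurableSpace (Equiv.Perm (Fin n)) := ⊤
  choose u hu hub using fun π : Equiv.Perm (Fin n) =>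
    exists_unit_vector fun d : A × A => kindCoeff d * Real.sqrt (pairCount hε k π d)
  set W : Equiv.Perm (Fin n) × (A × A → ℝ × ℝ) → ℝ := fun p =>
    pairCenter ε k p.1 + ∑ d, kindCoeff d * Q (pairCount hε k p.1 d) (p.2 d) with hW
  set Z : Equiv.Perm (Fin n) × (A × A → ℝ × ℝ) → ℝ := fun p =>
    Real.sqrt (k * (n - k) / n) * ∑ d, u p.1 d * (p.2 d).1 with hZ
  have hWm : Measurable W := by
    refine measurable_from_prod_countable_right fun π => ?_
    simp only [hW]
    fun_prop
  have hZm : Measurable Z := by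
    refine measurable_from_prod_countable_right fun π => ?_
    simp only [hZ]
    fun_prop
  refine ⟨_, _, couplingSpace (Equiv.Perm (Fin n)) (A × A), W, Z, inferInstance,
    ⟨hWm.aemeasurable, map_couplingSpace_eq_bridgeLaw hε k hQint hWm fun π w => rfl⟩,
    ⟨hZm.aemeasurable, map_couplingSpace_eq_gaussianReal hu hr0 hZm fun π w => rfl⟩, ?_⟩
  intro θ hθ
  have hDm : Measurable fun p => W p - η * Z p := hWm.sub (hZm.const_mul η)
  rcases le_or_gt θ 0 with hθ0 | hθ0
  · obtain ⟨h1, h2⟩ := integral_exp_le_one_of_nonpos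
      (couplingSpace (Equiv.Perm (Fin n)) (A × A)) hDm hθ0
    refine ⟨h1, h2.trans (Real.one_le_exp (by positivity))⟩
  have hθ₁ : θ * (144 * m * B) ≤ 1 := by
    have := hθ.trans (min_le_left _ _)
    rwa [le_div_iff₀ (by positivity)] at this
  have hθ₂ := hθ.trans (min_le_right _ _)
  obtain ⟨μ, hμ, ha⟩ := exists_sq_sqrt_pairVariance_sub_le hn hk hεB hν hη
  have hbound : ∀ π w, |W (π, w) - η * Z (π, w)|
      ≤ (2 * B + 18 * m * B) + 18 * B * ∑ d, (w d).1 ^ 2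
        + |Real.sqrt (pairVariance ε k π) - η * Real.sqrt (k * (n - k) / n)|
          * Real.sqrt (∑ d, (w d).1 ^ 2) := by
    intro π w
    simp only [hW, hZ]
    rw [← mul_assoc η]
    refine abs_coupling_error_le hB0.le (abs_pairCenter_le hk hB0.le hεB π) (fun d => ?_)
      (fun d => hQ _ _) (hu π) (fun d => ?_)
    · unfold kindCoeff
      have h1 := abs_le.1 (hAB _ d.1.2)
      have h2 := abs_le.1 (hAB _ d.2.2)
      rw [abs_le]
      constructor <;> linarith [h1.1, h1.2, h2.1, h2.2]
    · rw [pairVariance_eq_sum_kinds hε]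
      exact hub π d
  obtain ⟨hint, hle⟩ := integral_exp_couplingSpace_le (D := fun p => W p - η * Z p) hDm hθ0.le
    (C₁ := 18 * B) (by
      rw [le_div_iff₀ (by positivity), ← hm]
      linarith) hbound
  refine ⟨hint, hle.trans ?_⟩
  refine mul_sum_exp_le (V := pairVariance ε k) (μ := μ) hm0 hB1 hν hn0 hθ0.le ?_ hθ₂ hm1
    (sum_exp_sq_pairVariance_le hn k hB0 hεB hμ) ha
  have : 2 * B + 18 * m * B ≤ 144 * m * B := by nlinarith
  exact (mul_le_mul_of_nonneg_left this hθ0.le).trans hθ₁
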